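/- Identify $\mathbb R^2$ with $\mathbb C$, $z=x+iy$, and for $a,b\in\mathbb C$ put $a\cdot b=\mathrm{Re}(\bar a b)$, $a\wedge b=\mathrm{Im}(\bar a b)$. Let $\nu\in(-1,1)$ and $\kappa\in\mathbb R$. For a smooth bounded domain $\Omega\subset\mathbb R^2$ and $\eta=(\eta_+,\eta_-)\in H^1(\Omega;\mathbb C^2)$ let $$E(\eta)=\int_\Omega\big(e_{kin}(\eta)+\kappa^2e_{pot}(\eta)\big)\,dx,$$ where $$e_{kin}(\eta)=|\nabla\eta_+|^2+|\nabla\eta_-|^2+(1+\nu)\big[\partial_x\eta_+\cdot\partial_x\eta_--\partial_y\eta_+\cdot\partial_y\eta_-\big]+(1-\nu)\big[\partial_x\eta_-\wedge\partial_y\eta_+-\partial_x\eta_+\wedge\partial_y\eta_-\big],$$ $$e_{pot}(\eta)=\tfrac12(|\eta_+|^2-1)^2+\tfrac12(|\eta_-|^2-1)^2+2|\eta_+|^2|\eta_-|^2+\nu\,(\eta_+^2)\cdot(\eta_-^2).$$ **Theorem.** (i) Let $\Omega\subset\mathbb R^2$ be a smooth bounded domain, let $g_\pm\in H^{1/2}(\partial\Omega)$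 (the space of traces of $H^1(\Omega;\mathbb C)$ functions), and let $W$ be the set of $\eta\in H^1(\Omega;\mathbb C^2)$ with $\eta_\pm|_{\partial\Omega}=g_\pm$ in the sense of traces. Assume that $(\eta_+,\eta_-)=(c_++\alpha z,\;c_--\alpha\bar z)$ does not belong to $W$ for any constants $\alpha,c_+,c_-\in\mathbb C$. Then $E$ is finite on $W$ and has a minimizer in $W$. (ii) Let $\Omega=B_R$ be the disc of radius $R>0$ centred at $0$, and let $g_\pm=\alpha_\pm e^{in_\pm\theta}$ on $\partial B_R$ with $\alpha_\pm\in\mathbb C$, $n_\pm\in\mathbb Z$. Unless $n_+=1$, $n_-=-1$ and $\alpha_+=-\alpha_-$, the energy $E$ is finite on the corresponding class $W$ and has a minimizer in $W$. -/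

import Mathlib

open MeasureTheory Filter Topology
open scoped ContDiff ComplexConjugate ENNReal

noncomputable section

namespace PWave

/-! The plane `ℝ²` is identified with `ℂ` (Euclidean norm, Lebesgue measure), `z = x + i y`. -/

/-- A smooth bounded domain: a nonempty, connected, bounded open set whose boundary is locally
the zero set of a smooth function with nonvanishing gradient, the set lying on one side of it. -/
structure IsSmoothBoundedDomain (Ω : Set ℂ) : Prop where
  isOpen : IsOpen Ω
  isConnected : IsConnected Ω
  isBounded : Bornology.IsBounded Ω
  smooth_boundary : ∀ p ∈ frontier Ω, ∃ U : Set ℂ, IsOpen U ∧ p ∈ U ∧ ∃ ρ : ℂ → ℝ,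
    ContDiffOn ℝ ∞ ρ U ∧ (∀ x ∈ U, fderiv ℝ ρ x ≠ 0) ∧ Ω ∩ U = {x ∈ U | ρ x < 0}

/-- `w` is the weak derivative of `u` in the direction `v` on the open set `Ω`. -/
def IsWeakDeriv (Ω : Set ℂ) (v : ℂ) (u w : ℂ → ℂ) : Prop :=
  ∀ φ : ℂ → ℂ, ContDiff ℝ ∞ φ → HasCompactSupport φ → tsupport φ ⊆ Ω →
    ∫ z in Ω, u z * fderiv ℝ φ z v = - ∫ z in Ω, w z * φ z

/-- An element of the Sobolev space `H¹(Ω; ℂ)`: a square integrable function together with its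
square integrable weak partial derivatives (which are determined a.e. by the function). -/
structure H1 (Ω : Set ℂ) where
  /-- the function -/
  toFun : ℂ → ℂ
  /-- the weak derivative `∂ₓ` -/
  dx : ℂ → ℂ
  /-- the weak derivative `∂_y` -/
  dy : ℂ → ℂ
  memLp_toFun : MemLp toFun 2 (volume.restrict Ω)
  memLp_dx : MemLp dx 2 (volume.restrict Ω)
  memLp_dy : MemLp dy 2 (volume.restrict Ω)
  isWeakDeriv_dx : IsWeakDeriv Ω 1 toFun dx
  isWeakDeriv_dy : IsWeakDeriv Ω Complex.I toFun dy

/-- Arc length on the boundary of `Ω`. -/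
def bdryMeasure (Ω : Set ℂ) : Measure ℂ := (μH[1] : Measure ℂ).restrict (frontier Ω)

/-- `u|_{∂Ω} = g` in the sense of traces: the trace operator is the continuous extension, from
smooth functions on the closure of `Ω` to `H¹(Ω)`, of the restriction to the boundary, with values
in `L²(∂Ω)`. So `g` is the trace of `u` when some smooth functions `φ k` converge to `u` in
`H¹(Ω)` while their boundary restrictions converge to `g` in `L²(∂Ω)`. Only the values
of `g` on `∂Ω` matter. -/
def HasTrace {Ω : Set ℂ} (u : H1 Ω) (g : ℂ → ℂ) : Prop :=
  ∃ φ : ℕ → ℂ → ℂ, (∀ k, ContDiff ℝ ∞ (φ k)) ∧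
    Tendsto (fun k => eLpNorm (fun z => φ k z - u.toFun z) 2 (volume.restrict Ω)) atTop (𝓝 0) ∧
    Tendsto (fun k => eLpNorm (fun z => fderiv ℝ (φ k) z 1 - u.dx z) 2 (volume.restrict Ω))
      atTop (𝓝 0) ∧
    Tendsto (fun k => eLpNorm (fun z => fderiv ℝ (φ k) z Complex.I - u.dy z) 2
      (volume.restrict Ω)) atTop (𝓝 0) ∧
    Tendsto (fun k => eLpNorm (fun z => φ k z - g z) 2 (bdryMeasure Ω)) atTop (𝓝 0)

/-- `g ∈ H^{1/2}(∂Ω)`: the trace space of `H¹(Ω)`, inside `L²(∂Ω)`. -/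
def MemHHalf (Ω : Set ℂ) (g : ℂ → ℂ) : Prop :=
  MemLp g 2 (bdryMeasure Ω) ∧ ∃ u : H1 Ω, HasTrace u g

/-- The affine class `W` of pairs `η = (η₊, η₋)` in `H¹(Ω; ℂ²)` with boundary data
`(g₊, g₋)`; here and below `η.1 = η₊` and `η.2 = η₋`. -/
def W (Ω : Set ℂ) (gp gm : ℂ → ℂ) : Set (H1 Ω × H1 Ω) :=
  {η | HasTrace η.1 gp ∧ HasTrace η.2 gm}

/-- The scalar product of complex numbers seen as vectors of `ℝ²`. -/
def dot (a b : ℂ) : ℝ := a.re * b.re + a.im * b.im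

/-- The wedge product of complex numbers seen as vectors of `ℝ²`. -/
def wedge (a b : ℂ) : ℝ := a.re * b.im - a.im * b.re

/-- The kinetic energy density. -/
def eKin {Ω : Set ℂ} (ν : ℝ) (η : H1 Ω × H1 Ω) (z : ℂ) : ℝ :=
  (‖η.1.dx z‖ ^ 2 + ‖η.1.dy z‖ ^ 2) + (‖η.2.dx z‖ ^ 2 + ‖η.2.dy z‖ ^ 2)
    + (1 + ν) * (dot (η.1.dx z) (η.2.dx z) - dot (η.1.dy z) (η.2.dy z))
    + (1 - ν) * (wedge (η.2.dx z) (η.1.dy z) - wedge (η.1.dx z) (η.2.dy z))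

/-- The potential energy density. -/
def ePot {Ω : Set ℂ} (ν : ℝ) (η : H1 Ω × H1 Ω) (z : ℂ) : ℝ :=
  1 / 2 * (‖η.1.toFun z‖ ^ 2 - 1) ^ 2 + 1 / 2 * (‖η.2.toFun z‖ ^ 2 - 1) ^ 2
    + 2 * ‖η.1.toFun z‖ ^ 2 * ‖η.2.toFun z‖ ^ 2
    + ν * dot (η.1.toFun z ^ 2) (η.2.toFun z ^ 2)

/-- The p-wave energy density. -/
def energyDensity {Ω : Set ℂ} (ν κ : ℝ) (η : H1 Ω × H1 Ω) (z : ℂ) : ℝ :=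
  eKin ν η z + κ ^ 2 * ePot ν η z

/-- The p-wave energy `E(η)`. -/
def energy {Ω : Set ℂ} (ν κ : ℝ) (η : H1 Ω × H1 Ω) : ℝ :=
  ∫ z in Ω, energyDensity ν κ η z

/-- The energy is a well defined finite integral at every element of `W`, and it has a
minimizer in `W`. -/
def HasMinimizer (Ω : Set ℂ) (ν κ : ℝ) (gp gm : ℂ → ℂ) : Prop :=
  (∀ ζ ∈ W Ω gp gm, IntegrableOn (energyDensity ν κ ζ) Ω) ∧
    ∃ η ∈ W Ω gp gm, ∀ ζ ∈ W Ω gp gm, energy ν κ η ≤ energy ν κ ζ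

/-- The boundary datum `α e^{inθ}` where `e^{iθ} = z / |z|`. -/
def angularData (α : ℂ) (n : ℤ) (z : ℂ) : ℂ := α * (z / (‖z‖ : ℂ)) ^ n

end PWave

end

open MeasureTheory Filter Topology
open scoped ContDiff ComplexConjugate ENNReal

noncomputable section

namespace PWave

/-! The proof is the direct method; the point is coercivity. By `kinForm_eq` the kinetic density is
half the square of 2(∂η₊ + ∂̄η₋) plus a quadratic form in 2∂̄η₊ and 2∂η₋, positive definite because
|ν| < 1. It is therefore nonnegative, but it does not control the gradient pointwise: holomorphic η₊
and antiholomorphic η₋ can make it vanish. Coercivity is needed only on differences of two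
competitors, and these have zero trace. For such u the integral of the Jacobian ∂ₓu ∧ ∂_yu vanishes
(`inner_dx_dy_im_eq_zero`), so the L² norms of 2∂̄u and 2∂u both equal that of ∇u, and Poincaré's
inequality (`exists_norm_sq_le`) gives the full H¹ norm.

The potential is nonnegative, is integrable by the embedding of H¹ in L⁴ (`lintegral_pow_four_le`),
and is lower semicontinuous under L² convergence by Fatou (`lintegral_le_of_tendsto`). A minimizing
sequence is bounded by coercivity, so Rellich's theorem (`totallyBounded_traceGraph`) yields an L²
convergent subsequence. Instead of weak limits, `exists_isMinOn_add` takes convex combinations of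
tails that nearly minimize the kinetic energy. The parallelogram identity makes them Cauchy, and
their strong limit has kinetic energy at most the limit along the sequence.

All the analysis takes place in `traceGraph`, the closure in L² of the quadruples (φ, ∂ₓφ, ∂_yφ, φ
restricted to the boundary) with φ smooth. Of the boundary it uses only finite length. The
fundamental theorem of calculus on lines, with jumps at boundary points, is summed by an Eilenberg
type inequality (`exists_measurable_sum_fiber_le`). This bounds boundary terms without a normal
vector or charts, and integration by parts becomes exact as soon as one trace vanishes. -/

/-! ### The direct method for a quadratic form plus a lower semicontinuous term. -/

/-- Existence of minimizers of `Q + P` on a closed convex set, for a coercive quadratic `Q` and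
a functional `P` that is lower semicontinuous for a topology in which bounded sets are
precompact. -/
theorem exists_isMinOn_add {X Y : Type*} [NormedAddCommGroup X] [NormedSpace ℝ X]
    [CompleteSpace X] [NormedAddCommGroup Y] [NormedSpace ℝ Y] (π : X →L[ℝ] Y) {S : Set X}
    (hSc : IsClosed S) (hSconv : Convex ℝ S) (hSne : S.Nonempty) (Q : X → ℝ)
    (hQc : Continuous Q) (hQ0 : ∀ x, 0 ≤ Q x)
    (hQpar : ∀ x y, Q (x + y) + Q (x - y) = 2 * Q x + 2 * Q y)
    (C : ℝ) (hcoer : ∀ x ∈ S, ∀ y ∈ S, ‖x - y‖ ^ 2 ≤ C * Q (x - y))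
    (hcpt : ∀ (s : ℕ → X) (M : ℝ), (∀ n, s n ∈ S) → (∀ n, ‖s n‖ ≤ M) →
      ∃ (u : Y) (φ : ℕ → ℕ), StrictMono φ ∧ Tendsto (fun n => π (s (φ n))) atTop (𝓝 u))
    (P : Y → ℝ) (hP0 : ∀ y, 0 ≤ P y)
    (hPlsc : ∀ (s : ℕ → X) (x : X) (c : ℝ), (∀ n, s n ∈ S) → x ∈ S →
      Tendsto (fun n => π (s n)) atTop (𝓝 (π x)) → (∀ᶠ n in atTop, P (π (s n)) ≤ c) →
      P (π x) ≤ c) :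
    ∃ x ∈ S, ∀ y ∈ S, Q x + P (π x) ≤ Q y + P (π y) := by
  -- The parallelogram identity alone gives Q(0) = 0 and Q(2v) = 4Q(v), hence this midpoint form.
  have hQmid : ∀ x y, Q (x - y) = 2 * Q x + 2 * Q y - 4 * Q ((1 / 2 : ℝ) • (x + y)) := by
    intro x y
    have h0 := hQpar 0 0
    have h1 := hQpar ((1 / 2 : ℝ) • (x + y)) ((1 / 2 : ℝ) • (x + y))
    rw [← add_smul] at h1
    norm_num at h0 h1
    have h2 := hQpar x y
    norm_num
    linarith
  set E : X → ℝ := fun x => Q x + P (π x) with hE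
  have hE0 : ∀ x, 0 ≤ E x := fun x => add_nonneg (hQ0 x) (hP0 _)
  set m := sInf (E '' S) with hm
  have hbdd : BddBelow (E '' S) := ⟨0, by rintro _ ⟨x, -, rfl⟩; exact hE0 x⟩
  have hmle : ∀ y ∈ S, m ≤ E y := fun y hy => csInf_le hbdd ⟨y, hy, rfl⟩
  have hseq : ∀ n : ℕ, ∃ x ∈ S, E x < m + 1 / ((n : ℝ) + 1) := by
    intro n
    obtain ⟨_, ⟨x, hx, rfl⟩, hlt⟩ := exists_lt_of_csInf_lt (hSne.image E)
      (show sInf (E '' S) < m + 1 / ((n : ℝ) + 1) by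
        rw [← hm]; have : (0 : ℝ) < 1 / ((n : ℝ) + 1) := by positivity
        linarith)
    exact ⟨x, hx, hlt⟩
  choose s hsS hsE using hseq
  have hEs : Tendsto (fun n => E (s n)) atTop (𝓝 m) := by
    refine tendsto_of_tendsto_of_tendsto_of_le_of_le tendsto_const_nhds ?_
      (fun n => hmle _ (hsS n)) (fun n => (hsE n).le)
    simpa using tendsto_const_nhds.add (tendsto_one_div_add_atTop_nhds_zero_nat (𝕜 := ℝ))
  have hQb : ∀ n, Q (s n) ∈ Set.Icc 0 (m + 1) := by
    intro n
    refine ⟨hQ0 _, ?_⟩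
    have h1 : 1 / ((n : ℝ) + 1) ≤ 1 := by
      rw [div_le_one (by positivity)]; linarith [n.cast_nonneg (α := ℝ)]
    have := hP0 (π (s n)); have := hsE n; simp only [hE] at this; linarith
  have hCQ : ∀ x ∈ S, ∀ y ∈ S, ‖x - y‖ ^ 2 ≤ |C| * Q (x - y) := fun x hx y hy =>
    (hcoer x hx y hy).trans (mul_le_mul_of_nonneg_right (le_abs_self C) (hQ0 _))
  have hQsub : ∀ x y, Q (x - y) ≤ 2 * Q x + 2 * Q y := fun x y => by
    rw [hQmid]; linarith [hQ0 ((1 / 2 : ℝ) • (x + y))]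
  have hnorm : ∀ n, ‖s n‖ ≤ ‖s 0‖ + Real.sqrt (|C| * (4 * (m + 1))) := by
    intro n
    have h1 : ‖s n - s 0‖ ≤ Real.sqrt (|C| * (4 * (m + 1))) := by
      apply Real.le_sqrt_of_sq_le
      refine (hCQ _ (hsS n) _ (hsS 0)).trans (mul_le_mul_of_nonneg_left ?_ (abs_nonneg _))
      linarith [hQsub (s n) (s 0), (hQb n).2, (hQb 0).2]
    calc ‖s n‖ = ‖s 0 + (s n - s 0)‖ := by congr 1; abel
      _ ≤ _ := (norm_add_le _ _).trans (by linarith)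
  obtain ⟨u, φ, hφ, hu⟩ := hcpt s _ hsS hnorm
  obtain ⟨q, -, ψ, hψ, hq⟩ := isCompact_Icc.tendsto_subseq (fun n => hQb (φ n))
  set t : ℕ → X := fun n => s (φ (ψ n)) with ht
  have htS : ∀ n, t n ∈ S := fun n => hsS _
  have htu : Tendsto (fun n => π (t n)) atTop (𝓝 u) := hu.comp hψ.tendsto_atTop
  have htQ : Tendsto (fun n => Q (t n)) atTop (𝓝 q) := hq
  have htE : Tendsto (fun n => E (t n)) atTop (𝓝 m) :=
    hEs.comp (hφ.comp hψ).tendsto_atTop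
  -- A hands-on Mazur argument: the infimum of Q over the hull of the n-th tail increases with n and
  -- stays below q = lim Q(t n); near-minimizers over these hulls will converge in norm.
  set K : ℕ → Set X := fun n => convexHull ℝ (t '' Set.Ici n) with hK
  have hKS : ∀ n, K n ⊆ S := fun n =>
    convexHull_min (by rintro _ ⟨k, -, rfl⟩; exact htS k) hSconv
  have hKanti : ∀ {a b}, a ≤ b → K b ⊆ K a := fun hab =>
    convexHull_mono (Set.image_mono (Set.Ici_subset_Ici.2 hab))
  have htK : ∀ {n k}, n ≤ k → t k ∈ K n := fun hk => subset_convexHull ℝ _ ⟨_, hk, rfl⟩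
  set d : ℕ → ℝ := fun n => sInf (Q '' K n) with hd
  have hbd : ∀ n, BddBelow (Q '' K n) := fun n => ⟨0, by rintro _ ⟨x, -, rfl⟩; exact hQ0 x⟩
  have hdle : ∀ n, ∀ x ∈ K n, d n ≤ Q x := fun n x hx => csInf_le (hbd n) ⟨x, hx, rfl⟩
  have hdmono : Monotone d := fun a b hab =>
    csInf_le_csInf (hbd a) ⟨_, ⟨t b, htK le_rfl, rfl⟩⟩ (Set.image_mono (hKanti hab))
  have hdq : ∀ n, d n ≤ q := fun n => ge_of_tendsto htQ
    ((eventually_ge_atTop n).mono fun k hk => hdle n _ (htK hk))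
  have hseq2 : ∀ n : ℕ, ∃ x ∈ K n, Q x < d n + 1 / ((n : ℝ) + 1) := by
    intro n
    obtain ⟨_, ⟨x, hx, rfl⟩, hlt⟩ := exists_lt_of_csInf_lt
      (⟨_, ⟨t n, htK le_rfl, rfl⟩⟩ : (Q '' K n).Nonempty)
      (show sInf (Q '' K n) < d n + 1 / ((n : ℝ) + 1) by
        have : (0 : ℝ) < 1 / ((n : ℝ) + 1) := by positivity
        simp only [hd]; linarith)
    exact ⟨x, hx, hlt⟩
  choose x hxK hxQ using hseq2
  have hxS : ∀ n, x n ∈ S := fun n => hKS n (hxK n)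
  obtain ⟨D, hD⟩ : ∃ D, Tendsto d atTop (𝓝 D) :=
    ⟨_, tendsto_atTop_ciSup hdmono ⟨q, by rintro _ ⟨n, rfl⟩; exact hdq n⟩⟩
  have hDq : D ≤ q := le_of_tendsto' hD hdq
  have hdD : ∀ n, d n ≤ D := fun n => hdmono.ge_of_tendsto hD n
  -- For k ≥ n the midpoint of x n and x k is still in K n, so its Q is at least d n; `hQmid` then
  -- bounds Q(x n - x k) by 2(D - d n) + 4/(n+1).
  set b : ℕ → ℝ := fun n => Real.sqrt (|C| * (4 * (D - d n + 1 / ((n : ℝ) + 1)))) with hb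
  have hb0 : Tendsto b atTop (𝓝 0) := by
    have h1 : Tendsto (fun n : ℕ => |C| * (4 * (D - d n + 1 / ((n : ℝ) + 1)))) atTop
        (𝓝 (|C| * (4 * (D - D + 0)))) :=
      ((((tendsto_const_nhds.sub hD).add
        (tendsto_one_div_add_atTop_nhds_zero_nat (𝕜 := ℝ))).const_mul 4).const_mul _)
    simpa [hb] using h1.sqrt
  have hcau : CauchySeq x := by
    refine cauchySeq_of_le_tendsto_0' b (fun n k hnk => ?_) hb0
    rw [dist_eq_norm]
    apply Real.le_sqrt_of_sq_le
    refine (hCQ _ (hxS n) _ (hxS k)).trans (mul_le_mul_of_nonneg_left ?_ (abs_nonneg _))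
    have hmid : (1 / 2 : ℝ) • (x n + x k) ∈ K n := by
      rw [smul_add]
      exact convex_convexHull ℝ _ (hxK n) (hKanti hnk (hxK k)) (by norm_num) (by norm_num)
        (by norm_num)
    have h1 := hdle n _ hmid
    have h2 : 1 / ((k : ℝ) + 1) ≤ 1 / ((n : ℝ) + 1) := by
      have : (n : ℝ) ≤ k := by exact_mod_cast hnk
      gcongr
    rw [hQmid]
    linarith [hxQ n, hxQ k, hdD k, hdD n]
  obtain ⟨x0, hx0⟩ := cauchySeq_tendsto_of_complete hcau
  have hx0S : x0 ∈ S := hSc.mem_of_tendsto hx0 (Eventually.of_forall hxS)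
  have hQx0 : Q x0 ≤ q := by
    refine le_trans (le_of_tendsto_of_tendsto' ((hQc.tendsto x0).comp hx0)
      (hD.add (tendsto_one_div_add_atTop_nhds_zero_nat (𝕜 := ℝ))) (fun n => (hxQ n).le)) ?_
    linarith
  -- Preimages of balls under π are convex, so one containing a tail of t contains its convex hull.
  have hπx : Tendsto (fun n => π (x n)) atTop (𝓝 u) := by
    rw [Metric.tendsto_atTop]
    intro ε hε
    obtain ⟨N, hN⟩ := Metric.tendsto_atTop.1 htu ε hε
    refine ⟨N, fun n hn => ?_⟩
    have hsub : K n ⊆ π ⁻¹' Metric.ball u ε :=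
      convexHull_min (by rintro _ ⟨k, hk, rfl⟩; exact hN k (hn.trans hk))
        ((convex_ball u ε).linear_preimage π.toLinearMap)
    exact hsub (hxK n)
  have hπ0 : π x0 = u := tendsto_nhds_unique ((π.continuous.tendsto x0).comp hx0) hπx
  -- P is not convex, so semicontinuity is applied along t itself, which has the same image limit as
  -- x and along which P tends to m - q.
  have hPx0 : P (π x0) ≤ m - q := by
    refine le_of_forall_pos_le_add fun ε hε => ?_
    refine hPlsc t x0 _ htS hx0S (hπ0 ▸ htu) ?_
    have hlim : Tendsto (fun n => P (π (t n))) atTop (𝓝 (m - q)) := by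
      have := htE.sub htQ
      simpa [hE] using this
    exact (hlim.eventually (ge_mem_nhds (show m - q < m - q + ε by linarith)))
  refine ⟨x0, hx0S, fun y hy => ?_⟩
  have := hmle y hy
  simp only [hE] at this
  linarith

/-! ### The fundamental theorem of calculus on open subsets of a line. -/

/-- The fundamental theorem of calculus on an open set of reals whose boundary is contained in a
finite set `T`, with an error controlled by the boundary values. -/
theorem norm_indicator_sub_sub_integral_le {O : Set ℝ} (hO : IsOpen O) (T : Finset ℝ)
    (hT : frontier O ⊆ T) {f f' : ℝ → ℂ} (hf : ∀ x, HasDerivAt f (f' x) x)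
    (hf' : Continuous f') (n : ℕ) :
    ∀ a b : ℝ, a < b → (T.filter (· ∈ Set.Ioo a b)).card = n →
    ‖O.indicator f b - O.indicator f a - ∫ x in a..b, O.indicator f' x‖ ≤
      2 * ∑ t ∈ T.filter (· ∈ Set.Ioo a b), ‖f t‖ + (if a ∈ T then ‖f a‖ else 0)
        + (if b ∈ T then ‖f b‖ else 0) := by
  have hint : ∀ a b, IntervalIntegrable (O.indicator f') volume a b := fun a b =>
    ⟨(hf'.intervalIntegrable a b).1.indicator hO.measurableSet,
      (hf'.intervalIntegrable a b).2.indicator hO.measurableSet⟩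
  induction n using Nat.strong_induction_on with
  | _ n ih =>
  intro a b hab hn
  rcases (T.filter (· ∈ Set.Ioo a b)).eq_empty_or_nonempty with hemp | ⟨t, ht⟩
  · rw [hemp, Finset.sum_empty, mul_zero, zero_add]
    have hno : Set.Ioo a b ∩ frontier O = ∅ := by
      ext x
      simp only [Set.mem_inter_iff, Set.mem_empty_iff_false, iff_false, not_and]
      intro hx hxf
      have : x ∈ T.filter (· ∈ Set.Ioo a b) := Finset.mem_filter.2 ⟨hT hxf, hx⟩
      rw [hemp] at this
      exact absurd this (Finset.notMem_empty x)
    -- A connected set that misses the frontier lies on one side.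
    have hcases : Set.Ioo a b ⊆ O ∨ Disjoint (Set.Ioo a b) O := by
      by_contra! hcon
      obtain ⟨h1, h2⟩ := hcon
      have hfr : ∀ x ∈ Set.Ioo a b, x ∉ O → x ∉ closure O := fun x hx hxO hxc => by
        have : x ∈ Set.Ioo a b ∩ frontier O := ⟨hx, by rw [hO.frontier_eq]; exact ⟨hxc, hxO⟩⟩
        rw [hno] at this
        exact this
      obtain ⟨y, hy, hyO⟩ := Set.not_subset.1 h1
      obtain ⟨z, -, hzO, hzc⟩ := isPreconnected_Ioo (a := a) (b := b) O (closure O)ᶜ hO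
        isClosed_closure.isOpen_compl
        (fun x hx => (em (x ∈ O)).imp id (fun h => hfr x hx h))
        (Set.not_disjoint_iff_nonempty_inter.1 h2) ⟨y, hy, hfr y hy hyO⟩
      exact hzc (subset_closure hzO)
    rcases hcases with hsub | hdis
    · have hI : ∫ x in a..b, O.indicator f' x = f b - f a := by
        rw [← intervalIntegral.integral_eq_sub_of_hasDerivAt (fun x _ => hf x)
          (hf'.intervalIntegrable a b)]
        rw [intervalIntegral.integral_of_le hab.le, intervalIntegral.integral_of_le hab.le,
          integral_Ioc_eq_integral_Ioo, integral_Ioc_eq_integral_Ioo]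
        exact setIntegral_congr_fun measurableSet_Ioo fun x hx => by
          simp [Set.indicator_of_mem (hsub hx)]
      have hcl : Set.Icc a b ⊆ closure O := by
        rw [← closure_Ioo hab.ne]; exact closure_mono hsub
      -- An endpoint on the frontier is outside the open set O, so the indicator loses the value f c
      -- there.
      have hend : ∀ c ∈ Set.Icc a b, ‖O.indicator f c - f c‖ ≤ if c ∈ T then ‖f c‖ else 0 := by
        intro c hc
        by_cases hcO : c ∈ O
        · rw [Set.indicator_of_mem hcO, sub_self, norm_zero]; split_ifs <;> simp
        · have : c ∈ T := hT (by rw [hO.frontier_eq]; exact ⟨hcl hc, hcO⟩)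
          rw [Set.indicator_of_notMem hcO, if_pos this]; simp
      rw [hI, show O.indicator f b - O.indicator f a - (f b - f a)
        = (O.indicator f b - f b) - (O.indicator f a - f a) by ring]
      refine (norm_sub_le _ _).trans ?_
      have h1 := hend a ⟨le_rfl, hab.le⟩
      have h2 := hend b ⟨hab.le, le_rfl⟩
      linarith
    · have hI : ∫ x in a..b, O.indicator f' x = 0 := by
        rw [intervalIntegral.integral_of_le hab.le, integral_Ioc_eq_integral_Ioo]
        exact setIntegral_eq_zero_of_forall_eq_zero fun x hx =>
          Set.indicator_of_notMem (fun h => hdis.le_bot ⟨hx, h⟩) _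
      have hout : ∀ c ∈ Set.Icc a b, c ∉ O := by
        have : Disjoint (closure (Set.Ioo a b)) O := hdis.closure_left hO
        rw [closure_Ioo hab.ne] at this
        exact fun c hc hcO => this.le_bot ⟨hc, hcO⟩
      rw [hI, Set.indicator_of_notMem (hout a ⟨le_rfl, hab.le⟩),
        Set.indicator_of_notMem (hout b ⟨hab.le, le_rfl⟩)]
      simp only [sub_zero, norm_zero]
      positivity
  -- Cut at a point t of T. It is an endpoint of both halves, which is where the factor 2 on
  -- interior points comes from.
  · obtain ⟨htT, hat, htb⟩ := Finset.mem_filter.1 ht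
    have hsplit : T.filter (· ∈ Set.Ioo a b) =
        insert t (T.filter (· ∈ Set.Ioo a t) ∪ T.filter (· ∈ Set.Ioo t b)) := by
      ext x
      simp only [Finset.mem_filter, Set.mem_Ioo, Finset.mem_insert, Finset.mem_union]
      constructor
      · rintro ⟨hx, h1, h2⟩
        rcases lt_trichotomy x t with h | h | h
        · exact Or.inr (Or.inl ⟨hx, h1, h⟩)
        · exact Or.inl h
        · exact Or.inr (Or.inr ⟨hx, h, h2⟩)
      · rintro (rfl | ⟨hx, h1, h2⟩ | ⟨hx, h1, h2⟩)
        · exact ⟨htT, hat, htb⟩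
        · exact ⟨hx, h1, h2.trans htb⟩
        · exact ⟨hx, hat.trans h1, h2⟩
    have hdisj : Disjoint (T.filter (· ∈ Set.Ioo a t)) (T.filter (· ∈ Set.Ioo t b)) := by
      rw [Finset.disjoint_left]
      intro x h1 h2
      have := (Finset.mem_filter.1 h1).2.2
      have := (Finset.mem_filter.1 h2).2.1
      linarith
    have hnot : t ∉ T.filter (· ∈ Set.Ioo a t) ∪ T.filter (· ∈ Set.Ioo t b) := by simp
    have hcard := hn
    rw [hsplit, Finset.card_insert_of_notMem hnot, Finset.card_union_of_disjoint hdisj] at hcard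
    have h1 := ih _ (by omega) a t hat rfl
    have h2 := ih _ (by omega) t b htb rfl
    rw [if_pos htT] at h1 h2
    rw [hsplit, Finset.sum_insert hnot, Finset.sum_union hdisj,
      ← intervalIntegral.integral_add_adjacent_intervals (hint a t) (hint t b),
      show O.indicator f b - O.indicator f a -
        ((∫ x in a..t, O.indicator f' x) + ∫ x in t..b, O.indicator f' x)
        = (O.indicator f t - O.indicator f a - ∫ x in a..t, O.indicator f' x)
        + (O.indicator f b - O.indicator f t - ∫ x in t..b, O.indicator f' x) by ring]
    refine (norm_add_le _ _).trans ?_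
    linarith

/-! ### Fibres of Lipschitz projections and the length of the boundary. -/

/-- The half-open square of side `δ` of the grid `δ ℤ²` with index `k`. -/
def gridCell (δ : ℝ) (k : ℤ × ℤ) : Set ℂ := {z | ⌊z.re / δ⌋ = k.1 ∧ ⌊z.im / δ⌋ = k.2}

theorem measurableSet_gridCell (δ : ℝ) (k : ℤ × ℤ) : MeasurableSet (gridCell δ k) := by
  apply MeasurableSet.inter
  · exact (Int.measurable_floor.comp (Complex.measurable_re.div_const δ))
      (measurableSet_singleton k.1)
  · exact (Int.measurable_floor.comp (Complex.measurable_im.div_const δ))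
      (measurableSet_singleton k.2)

theorem dist_le_of_mem_gridCell {δ : ℝ} (hδ : 0 < δ) {k : ℤ × ℤ} {z w : ℂ}
    (hz : z ∈ gridCell δ k) (hw : w ∈ gridCell δ k) : dist z w ≤ 2 * δ := by
  have h1 := Int.abs_sub_lt_one_of_floor_eq_floor (hz.1.trans hw.1.symm)
  have h2 := Int.abs_sub_lt_one_of_floor_eq_floor (hz.2.trans hw.2.symm)
  rw [← sub_div, abs_div, abs_of_pos hδ, div_lt_one hδ] at h1 h2
  rw [Complex.dist_eq]
  refine (Complex.norm_le_abs_re_add_abs_im _).trans ?_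
  rw [Complex.sub_re, Complex.sub_im]
  linarith

theorem pairwise_disjoint_gridCell (δ : ℝ) : Pairwise (Function.onFun Disjoint (gridCell δ)) := by
  intro k l hkl
  rw [Function.onFun, Set.disjoint_left]
  intro z hz hw
  exact hkl (Prod.ext (hz.1.symm.trans hw.1) (hz.2.symm.trans hw.2))

/-- An Eilenberg type inequality: the integral over the line of the sum of `f` on the fibres of a
`1`-Lipschitz map is controlled by the integral of `f` for the one-dimensional Hausdorff measure. -/
theorem exists_measurable_sum_fiber_le {K : Set ℂ} (hK : MeasurableSet K) {π : ℂ → ℝ}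
    (hπ : LipschitzWith 1 π) {f : ℂ → ℝ≥0∞} (hf : Continuous f) :
    ∃ B : ℝ → ℝ≥0∞, Measurable B ∧ ∫⁻ y, B y ≤ ∫⁻ z in K, f z ∂(μH[1] : Measure ℂ) ∧
      ∀ y, ∀ T : Finset ℂ, (∀ p ∈ T, p ∈ K ∧ π p = y) → ∑ p ∈ T, f p ≤ B y := by
  set δ : ℕ → ℝ := fun n => 1 / ((n : ℝ) + 1) with hδdef
  have hδ : ∀ n, 0 < δ n := fun n => by simp only [hδdef]; positivity
  have hδ0 : Tendsto δ atTop (𝓝 0) := tendsto_one_div_add_atTop_nhds_zero_nat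
  set S : ℕ → ℤ × ℤ → Set ℂ := fun n k => K ∩ gridCell (δ n) k with hS
  -- Cell by cell, inf f times the length of the projection is at most the integral of f, since π
  -- does not increase length; Fatou then passes to fine grids. On an empty piece the infimum is ⊤,
  -- but its projection is null. Measurable hulls are used because a projected Borel set need not be
  -- Borel.
  set c : ℕ → ℤ × ℤ → ℝ≥0∞ := fun n k => ⨅ p ∈ S n k, f p with hc
  set A : ℕ → ℤ × ℤ → Set ℝ := fun n k => toMeasurable volume (π '' S n k) with hA
  set b : ℕ → ℝ → ℝ≥0∞ := fun n y => ∑' k, (A n k).indicator (fun _ => c n k) y with hb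
  have hSm : ∀ n k, MeasurableSet (S n k) := fun n k => hK.inter (measurableSet_gridCell _ _)
  have hbm : ∀ n, Measurable (b n) := fun n => Measurable.tsum fun k =>
    measurable_const.indicator (measurableSet_toMeasurable _ _)
  have hbI : ∀ n, ∫⁻ y, b n y ≤ ∫⁻ z in K, f z ∂(μH[1] : Measure ℂ) := by
    intro n
    simp only [hb]
    rw [lintegral_tsum fun k =>
      (measurable_const.indicator (measurableSet_toMeasurable _ _)).aemeasurable]
    calc ∑' k, ∫⁻ y, (A n k).indicator (fun _ => c n k) y
        ≤ ∑' k, ∫⁻ z in S n k, f z ∂(μH[1] : Measure ℂ) := by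
          refine ENNReal.tsum_le_tsum fun k => ?_
          rw [lintegral_indicator_const (measurableSet_toMeasurable _ _), measure_toMeasurable]
          have h1 : volume (π '' S n k) ≤ (μH[1] : Measure ℂ) (S n k) := by
            rw [← hausdorffMeasure_real]
            simpa using hπ.hausdorffMeasure_image_le zero_le_one (S n k)
          calc c n k * volume (π '' S n k) ≤ c n k * (μH[1] : Measure ℂ) (S n k) := by gcongr
            _ = ∫⁻ z in S n k, c n k ∂(μH[1] : Measure ℂ) := by
              rw [lintegral_const, Measure.restrict_apply MeasurableSet.univ, Set.univ_inter]
            _ ≤ _ := setLIntegral_mono' (hSm n k) fun z hz => iInf₂_le z hz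
      _ = ∫⁻ z in ⋃ k, S n k, f z ∂(μH[1] : Measure ℂ) :=
          (lintegral_iUnion (hSm n) (fun k l hkl =>
            ((pairwise_disjoint_gridCell (δ n) hkl).mono Set.inter_subset_right
              Set.inter_subset_right)) f).symm
      _ ≤ _ := lintegral_mono_set (Set.iUnion_subset fun k => Set.inter_subset_left)
  refine ⟨fun y => liminf (fun n => b n y) atTop, Measurable.liminf hbm, ?_, ?_⟩
  · refine (lintegral_liminf_le hbm).trans ?_
    calc liminf (fun n => ∫⁻ y, b n y) atTop
        ≤ liminf (fun _ : ℕ => ∫⁻ z in K, f z ∂(μH[1] : Measure ℂ)) atTop :=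
          liminf_le_liminf (Eventually.of_forall hbI)
      _ = _ := liminf_const _
  · intro y T hT
    set κ : ℕ → ℂ → ℤ × ℤ := fun n p => (⌊p.re / δ n⌋, ⌊p.im / δ n⌋) with hκ
    have hκm : ∀ n p, p ∈ gridCell (δ n) (κ n p) := fun n p => ⟨rfl, rfl⟩
    have hlim : ∀ p ∈ T, Tendsto (fun n => c n (κ n p)) atTop (𝓝 (f p)) := by
      intro p hp
      rw [tendsto_order]
      constructor
      · intro a ha
        obtain ⟨a', haa', ha'⟩ := exists_between ha
        obtain ⟨r, hr, hball⟩ := Metric.eventually_nhds_iff.1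
          ((hf.tendsto p).eventually (lt_mem_nhds ha'))
        have : ∀ᶠ n in atTop, 2 * δ n < r := by
          have := hδ0.const_mul 2
          rw [mul_zero] at this
          exact this.eventually (gt_mem_nhds hr)
        filter_upwards [this] with n hn
        refine haa'.trans_le (le_iInf₂ fun q hq => (hball ?_).le)
        exact (dist_le_of_mem_gridCell (hδ n) hq.2 (hκm n p)).trans_lt hn
      · intro a ha
        exact Eventually.of_forall fun n =>
          (iInf₂_le p (show p ∈ S n (κ n p) from ⟨(hT p hp).1, hκm n p⟩)).trans_lt ha
    have hsum : Tendsto (fun n => ∑ p ∈ T, c n (κ n p)) atTop (𝓝 (∑ p ∈ T, f p)) :=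
      tendsto_finsetSum _ hlim
    rw [← hsum.liminf_eq]
    refine liminf_le_liminf ?_
    -- On a fine enough grid the points of T occupy distinct cells, so each contributes its own term
    -- of `b n y`.
    have hinj : ∀ᶠ n in atTop, ∀ p ∈ T, ∀ q ∈ T, p ≠ q → κ n p ≠ κ n q := by
      rw [Finset.eventually_all]
      intro p _
      rw [Finset.eventually_all]
      intro q _
      by_cases hpq : p = q
      · exact Eventually.of_forall fun n h => absurd hpq h
      have : ∀ᶠ n in atTop, 2 * δ n < dist p q := by
        have := hδ0.const_mul 2
        rw [mul_zero] at this
        exact this.eventually (gt_mem_nhds (dist_pos.2 hpq))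
      filter_upwards [this] with n hn _ heq
      have h1 := hκm n p
      rw [heq] at h1
      exact absurd (dist_le_of_mem_gridCell (hδ n) h1 (hκm n q)) (not_le.2 hn)
    filter_upwards [hinj] with n hn
    calc ∑ p ∈ T, c n (κ n p)
        = ∑ p ∈ T, (A n (κ n p)).indicator (fun _ => c n (κ n p)) y := by
          refine Finset.sum_congr rfl fun p hp => ?_
          rw [Set.indicator_of_mem]
          exact subset_toMeasurable _ _ ⟨p, ⟨(hT p hp).1, hκm n p⟩, (hT p hp).2⟩
      _ = ∑ k ∈ T.image (κ n), (A n k).indicator (fun _ => c n k) y := by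
          rw [Finset.sum_image]
          intro p hp q hq h
          by_contra hpq
          exact hn p hp q hq hpq h
      _ ≤ b n y := ENNReal.sum_le_tsum _

/-- A curve which is locally the zero set of a function with nonvanishing differential has
locally finite length. -/
theorem exists_nhds_hausdorffMeasure_zeroSet_lt_top {ρ : ℂ → ℝ} {p : ℂ} {ρ' : ℂ →L[ℝ] ℝ}
    (hρ : HasStrictFDerivAt ρ ρ' p) (hne : ρ' ≠ 0) :
    ∃ V ∈ 𝓝 p, (μH[1] : Measure ℂ) {z ∈ V | ρ z = 0} < ⊤ := by
  set a := ρ' 1 with ha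
  set b := ρ' Complex.I with hb
  have hlin : ∀ v : ℂ, ρ' v = a * v.re + b * v.im := by
    intro v
    have : v = v.re • (1 : ℂ) + v.im • Complex.I := by
      simp [Complex.re_add_im]
    conv_lhs => rw [this]
    rw [map_add, map_smul, map_smul, ← ha, ← hb, smul_eq_mul, smul_eq_mul]
    ring
  -- an estimate of the increments along the zero set by their projection
  have key : ∀ (s t : ℝ), s ≠ 0 → ∀ x y : ℝ, |s * x + t * y| ≤ |s| / 2 * (|x| + |y|) →
      |x| + |y| ≤ (2 * |t| / |s| + 2) * |y| := by
    intro s t hs x y h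
    have hs' : 0 < |s| := abs_pos.2 hs
    have h1 : |s| * |x| ≤ |s * x + t * y| + |t| * |y| := by
      rw [← abs_mul, ← abs_mul]
      calc |s * x| = |(s * x + t * y) - t * y| := by ring_nf
        _ ≤ _ := abs_sub _ _
    have h2 : |s| * (|x| + |y|) ≤ (2 * |t| + 2 * |s|) * |y| := by nlinarith
    have : (2 * |t| / |s| + 2) * |y| = ((2 * |t| + 2 * |s|) * |y|) / |s| := by field_simp
    rw [this, le_div_iff₀ hs']
    linarith
  -- Strict differentiability makes increments along the zero set almost tangent. If a ≠ 0, the real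
  -- part of an increment is controlled by its imaginary part, so projection to the imaginary axis
  -- is antilipschitz; otherwise b ≠ 0 and the roles are exchanged.
  have main : ∃ (π : ℂ → ℝ) (L : NNReal) (V : Set ℂ), LipschitzWith 1 π ∧ V ∈ 𝓝 p ∧
      ∀ z ∈ V, ∀ w ∈ V, ρ z = 0 → ρ w = 0 → dist z w ≤ L * dist (π z) (π w) := by
    have aux : ∀ ε : ℝ, 0 < ε → ∃ V ∈ 𝓝 p, ∀ z ∈ V, ∀ w ∈ V, ρ z = 0 → ρ w = 0 →
        |a * (z - w).re + b * (z - w).im| ≤ ε * (|(z - w).re| + |(z - w).im|) := by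
      intro ε hε
      have h := (hasStrictFDerivAt_iff_isLittleO.1 hρ).def hε
      rw [nhds_prod_eq] at h
      obtain ⟨V, hV, hVp⟩ := eventually_prod_self_iff'.1 h
      refine ⟨V, hV, fun z hz w hw h1 h2 => ?_⟩
      have := hVp z hz w hw
      simp only [h1, h2, sub_zero, zero_sub, norm_neg, Real.norm_eq_abs, hlin] at this
      exact this.trans (mul_le_mul_of_nonneg_left (Complex.norm_le_abs_re_add_abs_im _) hε.le)
    by_cases ha0 : a = 0
    · have hb0 : b ≠ 0 := by
        intro hb0
        exact hne (ContinuousLinearMap.ext fun v => by simp [hlin, ha0, hb0])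
      obtain ⟨V, hV, hVp⟩ := aux (|b| / 2) (by positivity)
      refine ⟨Complex.re, ⟨2 * |a| / |b| + 2, by positivity⟩, V, ?_, hV, ?_⟩
      · exact LipschitzWith.of_dist_le_mul fun z w => by
          rw [Real.dist_eq, Complex.dist_eq, ← Complex.sub_re, NNReal.coe_one, one_mul]
          exact Complex.abs_re_le_norm _
      · intro z hz w hw h1 h2
        rw [Complex.dist_eq, Real.dist_eq, ← Complex.sub_re]
        refine (Complex.norm_le_abs_re_add_abs_im _).trans ?_
        rw [add_comm]
        refine key b a hb0 _ _ ?_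
        rw [add_comm, add_comm |_|]
        exact hVp z hz w hw h1 h2
    · obtain ⟨V, hV, hVp⟩ := aux (|a| / 2) (by positivity)
      refine ⟨Complex.im, ⟨2 * |b| / |a| + 2, by positivity⟩, V, ?_, hV, ?_⟩
      · exact LipschitzWith.of_dist_le_mul fun z w => by
          rw [Real.dist_eq, Complex.dist_eq, ← Complex.sub_im, NNReal.coe_one, one_mul]
          exact Complex.abs_im_le_norm _
      · intro z hz w hw h1 h2
        rw [Complex.dist_eq, Real.dist_eq, ← Complex.sub_im]
        refine (Complex.norm_le_abs_re_add_abs_im _).trans ?_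
        exact key a b ha0 _ _ (hVp z hz w hw h1 h2)
  obtain ⟨π, L, V, hπ, hV, hVL⟩ := main
  refine ⟨V ∩ Metric.ball p 1, inter_mem hV (Metric.ball_mem_nhds p one_pos), ?_⟩
  set Z := {z ∈ V ∩ Metric.ball p 1 | ρ z = 0} with hZ
  have hanti : AntilipschitzWith L (fun z : Z => π z) := by
    refine AntilipschitzWith.of_le_mul_dist fun z w => ?_
    exact hVL z z.2.1.1 w w.2.1.1 z.2.2 w.2.2
  have h1 := hanti.le_hausdorffMeasure_image zero_le_one (Set.univ : Set Z)
  have h2 : (μH[1] : Measure Z) Set.univ = (μH[1] : Measure ℂ) Z := by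
    rw [← isometry_subtype_coe.hausdorffMeasure_image (Or.inl zero_le_one)]
    simp
  rw [h2] at h1
  refine h1.trans_lt (ENNReal.mul_lt_top (by simp) ?_)
  rw [hausdorffMeasure_real]
  refine Bornology.IsBounded.measure_lt_top ?_
  refine (Metric.isBounded_ball (x := π p) (r := 1)).subset ?_
  rintro _ ⟨z, -, rfl⟩
  rw [Metric.mem_ball]
  refine (hπ.dist_le_mul _ _).trans_lt ?_
  rw [NNReal.coe_one, one_mul]
  exact z.2.1.2

/-- By compactness this is local. A frontier point is outside the open set Ω, so ρ ≥ 0 there; ρ > 0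
would keep a neighbourhood away from Ω. Hence the frontier lies in the zero set of ρ. -/
theorem IsSmoothBoundedDomain.hausdorffMeasure_frontier_lt_top {Ω : Set ℂ}
    (h : IsSmoothBoundedDomain Ω) : (μH[1] : Measure ℂ) (frontier Ω) < ⊤ := by
  have hcpt : IsCompact (frontier Ω) :=
    Metric.isCompact_of_isClosed_isBounded isClosed_frontier
      (h.isBounded.closure.subset frontier_subset_closure)
  refine hcpt.measure_lt_top_of_nhdsWithin fun p hp => ?_
  obtain ⟨U, hU, hpU, ρ, hρ, hρ', hΩ⟩ := h.smooth_boundary p hp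
  have hat : ContDiffAt ℝ ∞ ρ p := hρ.contDiffAt (hU.mem_nhds hpU)
  obtain ⟨V, hV, hfin⟩ := exists_nhds_hausdorffMeasure_zeroSet_lt_top
    (hat.hasStrictFDerivAt (by simp)) (hρ' p hpU)
  refine ⟨frontier Ω ∩ (V ∩ U), ?_, (measure_mono ?_).trans_lt hfin⟩
  · exact inter_mem_nhdsWithin _ (inter_mem hV (hU.mem_nhds hpU))
  · rintro z ⟨hz, hzV, hzU⟩
    refine ⟨hzV, ?_⟩
    have hcz : ContinuousAt ρ z := (hρ.continuousOn).continuousAt (hU.mem_nhds hzU)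
    have hzΩ : z ∉ Ω := by
      rw [h.isOpen.frontier_eq] at hz
      exact hz.2
    have hge : 0 ≤ ρ z := by
      by_contra! hlt
      have : z ∈ Ω ∩ U := by rw [hΩ]; exact ⟨hzU, hlt⟩
      exact hzΩ this.1
    refine le_antisymm ?_ hge
    by_contra! hgt
    have hev : ∀ᶠ w in 𝓝 z, 0 < ρ w ∧ w ∈ U :=
      (hcz.eventually (lt_mem_nhds hgt)).and (hU.mem_nhds hzU)
    obtain ⟨w, ⟨hw1, hw2⟩, hw3⟩ := mem_closure_iff_nhds.1 (frontier_subset_closure hz) _ hev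
    have : w ∈ Ω ∩ U := ⟨hw3, hw2⟩
    rw [hΩ] at this
    exact absurd this.2 (not_lt.2 hw1.le)

/-! ### Integration along lines and inequalities with boundary terms. -/

/-- A decomposition `z = s v + y w`, `y = π z`, of the plane into lines parallel to `v`. -/
structure IsFrame (v w : ℂ) (π : ℂ → ℝ) : Prop where
  lipschitz : LipschitzWith 1 π
  proj : ∀ s y : ℝ, π (s • v + y • w) = y
  norm_dir : ‖v‖ = 1
  measurePreserving : MeasurePreserving (fun p : ℝ × ℝ => (p.2 • v + p.1 • w : ℂ))
    (volume.prod volume) volume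

theorem isFrame_I_one : IsFrame Complex.I 1 Complex.re where
  lipschitz := LipschitzWith.of_dist_le_mul fun z w => by
    rw [Real.dist_eq, Complex.dist_eq, ← Complex.sub_re, NNReal.coe_one, one_mul]
    exact Complex.abs_re_le_norm _
  proj s y := by simp
  norm_dir := by simp
  measurePreserving := by
    have h : (fun p : ℝ × ℝ => (p.2 • Complex.I + p.1 • 1 : ℂ))
        = Complex.measurableEquivRealProd.symm := by
      funext p
      rw [Complex.measurableEquivRealProd_symm_apply]
      apply Complex.ext <;> simp
    rw [h]
    exact Complex.volume_preserving_equiv_real_prod.symm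

theorem isFrame_one_I : IsFrame 1 Complex.I Complex.im where
  lipschitz := LipschitzWith.of_dist_le_mul fun z w => by
    rw [Real.dist_eq, Complex.dist_eq, ← Complex.sub_im, NNReal.coe_one, one_mul]
    exact Complex.abs_im_le_norm _
  proj s y := by simp
  norm_dir := by simp
  measurePreserving := by
    have := isFrame_I_one.measurePreserving.comp
      (Measure.measurePreserving_swap (μ := (volume : Measure ℝ)) (ν := (volume : Measure ℝ)))
    convert this using 1
    ext p
    simp [add_comm]

/-- With f = 1 the Eilenberg bound B dominates the number of points in any finite part of a fibre,
and B has finite integral. -/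
theorem ae_finite_fiber {K : Set ℂ} (hK : MeasurableSet K)
    (hfin : (μH[1] : Measure ℂ) K < ⊤) {π : ℂ → ℝ} (hπ : LipschitzWith 1 π) :
    ∀ᵐ y : ℝ, {p | p ∈ K ∧ π p = y}.Finite := by
  obtain ⟨B, hBm, hBI, hB⟩ := exists_measurable_sum_fiber_le hK hπ (f := fun _ => 1)
    continuous_const
  have hlt : ∫⁻ y, B y ≠ ⊤ := by
    refine (hBI.trans_lt ?_).ne
    simpa using hfin
  filter_upwards [ae_lt_top hBm hlt] with y hy
  by_contra hinf
  refine hy.ne (ENNReal.eq_top_of_forall_nnreal_le fun r => ?_)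
  obtain ⟨n, hn⟩ := exists_nat_ge r
  obtain ⟨T, hT, hTn⟩ := Set.Infinite.exists_subset_card_eq hinf n
  have := hB y T (fun p hp => hT hp)
  rw [Finset.sum_const, hTn, nsmul_eq_mul, mul_one] at this
  refine le_trans ?_ this
  exact_mod_cast hn

/-- The function along a line of the frame. -/
theorem hasDerivAt_line {F : ℂ → ℂ} (hF : ContDiff ℝ 1 F) (v c : ℂ) (s : ℝ) :
    HasDerivAt (fun s : ℝ => F (s • v + c)) (fderiv ℝ F (s • v + c) v) s := by
  have h1 : HasDerivAt (fun s : ℝ => s • v + c) v s := by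
    simpa using ((hasDerivAt_id s).smul_const v).add_const c
  exact ((hF.differentiable (by simp)) _).hasFDerivAt.comp_hasDerivAt s h1

theorem continuous_fderiv_line {F : ℂ → ℂ} (hF : ContDiff ℝ 1 F) (v c : ℂ) :
    Continuous (fun s : ℝ => fderiv ℝ F (s • v + c) v) := by
  have := hF.continuous_fderiv (by simp)
  fun_prop

/-- The boundary form of the fundamental theorem of calculus on a line meeting the boundary of the
open set in finitely many points. -/
theorem enorm_line_le {Ω : Set ℂ} (hΩ : IsOpen Ω) (hb : Bornology.IsBounded Ω) {v w : ℂ}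
    {π : ℂ → ℝ} (hfr : IsFrame v w π) {F : ℂ → ℂ} (hF : ContDiff ℝ 1 F) {y : ℝ} {b : ℝ≥0∞}
    (hfin : {p | p ∈ frontier Ω ∧ π p = y}.Finite)
    (hsum : ∀ T : Finset ℂ, (∀ p ∈ T, p ∈ frontier Ω ∧ π p = y) → ∑ p ∈ T, ‖F p‖ₑ ≤ b) :
    ‖∫ s : ℝ, Ω.indicator (fun z => fderiv ℝ F z v) (s • v + y • w)‖ₑ ≤ 2 * b ∧
    ∀ s : ℝ, ‖Ω.indicator F (s • v + y • w)‖ₑ ≤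
      (∫⁻ s : ℝ, ‖Ω.indicator (fun z => fderiv ℝ F z v) (s • v + y • w)‖ₑ) + 2 * b := by
  set e : ℝ → ℂ := fun s => s • v + y • w with he
  have hec : Continuous e := by fun_prop
  have hv : v ≠ 0 := fun h => by simpa [h] using hfr.norm_dir
  have hinj : Function.Injective e := fun s t h => by
    have : (s - t) • v = 0 := by
      have h' : s • v + y • w = t • v + y • w := h
      rw [sub_smul, sub_eq_zero]; exact add_right_cancel h'
    rcases smul_eq_zero.1 this with h | h
    · linarith
    · exact absurd h hv
  set O : Set ℝ := e ⁻¹' Ω with hO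
  have hOo : IsOpen O := hΩ.preimage hec
  have hTfin : (e ⁻¹' frontier Ω).Finite := by
    refine (hfin.preimage hinj.injOn).subset fun s hs => ⟨hs, hfr.proj s y⟩
  set T : Finset ℝ := hTfin.toFinset with hT
  have hfT : frontier O ⊆ T := by
    rw [hT, Set.Finite.coe_toFinset]
    exact hec.frontier_preimage_subset Ω
  set f : ℝ → ℂ := fun s => F (e s) with hf
  set f' : ℝ → ℂ := fun s => fderiv ℝ F (e s) v with hf'
  have hder : ∀ s, HasDerivAt f (f' s) s := fun s => hasDerivAt_line hF v (y • w) s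
  have hf'c : Continuous f' := continuous_fderiv_line hF v (y • w)
  have hsumT : ∑ t ∈ T, ‖f t‖ₑ ≤ b := by
    have := hsum (T.map ⟨e, hinj⟩) (by
      intro p hp
      obtain ⟨t, ht, rfl⟩ := Finset.mem_map.1 hp
      exact ⟨hTfin.mem_toFinset.1 ht, hfr.proj t y⟩)
    simpa [Finset.sum_map] using this
  -- Beyond parameter M the line has left the closure of Ω, so ±M carry neither a value nor an
  -- endpoint error.
  obtain ⟨M, hM0, hM⟩ : ∃ M : ℝ, 0 < M ∧ ∀ s : ℝ, s ∈ O ∪ (T : Set ℝ) → |s| < M := by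
    obtain ⟨R, hR⟩ := hb.closure.exists_norm_le
    refine ⟨max (R + ‖y • w‖) 0 + 1, by positivity, fun s hs => ?_⟩
    have hs' : e s ∈ closure Ω := by
      rcases hs with hs | hs
      · exact subset_closure hs
      · exact frontier_subset_closure (hTfin.mem_toFinset.1 hs)
    have h1 : |s| = ‖e s - y • w‖ := by
      simp only [he, add_sub_cancel_right, norm_smul, hfr.norm_dir, mul_one, Real.norm_eq_abs]
    rw [h1]
    have := (norm_sub_le (e s) (y • w)).trans (add_le_add_left (hR _ hs') _)
    exact this.trans_lt (lt_of_le_of_lt (le_max_left _ _) (lt_add_one _))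
  change ‖∫ s : ℝ, O.indicator f' s‖ₑ ≤ 2 * b ∧ ∀ s : ℝ, ‖O.indicator f s‖ₑ ≤
    (∫⁻ s : ℝ, ‖O.indicator f' s‖ₑ) + 2 * b
  have hout : ∀ c : ℝ, M ≤ |c| → c ∉ T ∧ c ∉ O := fun c hc =>
    ⟨fun h => absurd (hM c (Or.inr h)) (not_lt.2 hc),
      fun h => absurd (hM c (Or.inl h)) (not_lt.2 hc)⟩
  have hpart : ∀ U : Finset ℝ, U ⊆ T → ENNReal.ofReal (∑ t ∈ U, ‖f t‖) ≤ b := by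
    intro U hU
    rw [ENNReal.ofReal_sum_of_nonneg fun _ _ => norm_nonneg _]
    simp only [ofReal_norm]
    exact (Finset.sum_le_sum_of_subset hU).trans hsumT
  constructor
  · have hI : ∫ s : ℝ, O.indicator f' s = ∫ s in (-M)..M, O.indicator f' s := by
      rw [intervalIntegral.integral_of_le (by linarith), setIntegral_eq_integral_of_forall_compl_eq_zero]
      intro s hs
      refine Set.indicator_of_notMem (fun h => hs ?_) _
      have := abs_lt.1 (hM s (Or.inl h))
      exact ⟨this.1, this.2.le⟩
    have h := norm_indicator_sub_sub_integral_le hOo T hfT hder hf'c _ (-M) M (by linarith) rfl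
    have h1 := hout (-M) (by rw [abs_neg]; exact le_abs_self M)
    have h2 := hout M (le_abs_self M)
    rw [if_neg h1.1, if_neg h2.1, Set.indicator_of_notMem h1.2, Set.indicator_of_notMem h2.2,
      ← hI, sub_self, zero_sub, norm_neg, add_zero, add_zero] at h
    rw [← ofReal_norm]
    refine (ENNReal.ofReal_le_ofReal h).trans ?_
    rw [ENNReal.ofReal_mul zero_le_two]
    gcongr
    · simp
    · exact hpart _ (Finset.filter_subset _ _)
  · intro s
    by_cases hs : s ∈ O
    swap
    · simp [Set.indicator_of_notMem hs]
    -- The starting point is inside the open set, so only the frontier points between s and M cost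
    -- anything.
    have hsT : s ∉ T := by
      intro h
      have h1 : e s ∈ frontier Ω := hTfin.mem_toFinset.1 h
      rw [hΩ.frontier_eq] at h1
      exact h1.2 hs
    have hsM := abs_lt.1 (hM s (Or.inl hs))
    have h := norm_indicator_sub_sub_integral_le hOo T hfT hder hf'c _ s M hsM.2 rfl
    have h2 := hout M (le_abs_self M)
    rw [if_neg hsT, if_neg h2.1, Set.indicator_of_notMem h2.2, add_zero, add_zero] at h
    have h3 : ‖O.indicator f s‖ ≤ ‖∫ x in s..M, O.indicator f' x‖ +
        2 * ∑ t ∈ T.filter (· ∈ Set.Ioo s M), ‖f t‖ := by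
      have : O.indicator f s = - (∫ x in s..M, O.indicator f' x) -
        (0 - O.indicator f s - ∫ x in s..M, O.indicator f' x) := by ring
      rw [this]
      refine (norm_sub_le _ _).trans ?_
      rw [norm_neg]
      gcongr
    rw [← ofReal_norm]
    refine (ENNReal.ofReal_le_ofReal h3).trans ?_
    rw [ENNReal.ofReal_add (norm_nonneg _) (by positivity), ENNReal.ofReal_mul zero_le_two]
    gcongr
    · rw [ofReal_norm, intervalIntegral.integral_of_le hsM.2.le]
      exact (enorm_integral_le_lintegral_enorm _).trans (setLIntegral_le_lintegral _ _)
    · simp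
    · exact hpart _ (Finset.filter_subset _ _)

theorem integrable_indicator_of_continuous {Ω : Set ℂ} (hΩ : IsOpen Ω)
    (hb : Bornology.IsBounded Ω) {h : ℂ → ℂ} (hh : Continuous h) :
    Integrable (Ω.indicator h) := by
  rw [integrable_indicator_iff hΩ.measurableSet]
  exact (hh.continuousOn.integrableOn_compact hb.isCompact_closure).mono_set subset_closure

/-- The boundary bound for integrals of derivatives, a weak form of the divergence theorem. -/
theorem enorm_setIntegral_fderiv_le {Ω : Set ℂ} (hΩ : IsOpen Ω) (hb : Bornology.IsBounded Ω)
    (hfin : (μH[1] : Measure ℂ) (frontier Ω) < ⊤) {v w : ℂ} {π : ℂ → ℝ} (hfr : IsFrame v w π)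
    {F : ℂ → ℂ} (hF : ContDiff ℝ 1 F) :
    ‖∫ z in Ω, fderiv ℝ F z v‖ₑ ≤ 2 * ∫⁻ z in frontier Ω, ‖F z‖ₑ ∂(μH[1] : Measure ℂ) := by
  obtain ⟨B, hBm, hBI, hB⟩ := exists_measurable_sum_fiber_le
    (isClosed_frontier (s := Ω)).measurableSet hfr.lipschitz (f := fun z => ‖F z‖ₑ)
    hF.continuous.enorm
  have hcont : Continuous fun z => fderiv ℝ F z v := by
    have := hF.continuous_fderiv (by simp)
    fun_prop
  have hint := integrable_indicator_of_continuous hΩ hb hcont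
  have hmp := hfr.measurePreserving
  have h1 : ∫ z in Ω, fderiv ℝ F z v = ∫ y : ℝ, ∫ s : ℝ,
      Ω.indicator (fun z => fderiv ℝ F z v) (s • v + y • w) := by
    rw [← integral_indicator hΩ.measurableSet]
    conv_lhs => rw [← hmp.map_eq]
    rw [integral_map hmp.measurable.aemeasurable (by rw [hmp.map_eq]; exact hint.1)]
    exact integral_prod _ (hmp.integrable_comp_of_integrable hint)
  rw [h1]
  calc _ ≤ ∫⁻ y : ℝ, ‖∫ s : ℝ, Ω.indicator (fun z => fderiv ℝ F z v) (s • v + y • w)‖ₑ :=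
        enorm_integral_le_lintegral_enorm _
    _ ≤ ∫⁻ y : ℝ, 2 * B y := by
        refine lintegral_mono_ae ?_
        filter_upwards [ae_finite_fiber isClosed_frontier.measurableSet hfin hfr.lipschitz]
          with y hy
        exact (enorm_line_le hΩ hb hfr hF hy (hB y)).1
    _ = 2 * ∫⁻ y, B y := lintegral_const_mul _ hBm
    _ ≤ _ := by gcongr

/-- The bound on a line does not depend on the position s along it. This is what lets two such
bounds, in perpendicular directions, be multiplied and integrated separately. -/
theorem exists_measurable_line_bound {Ω : Set ℂ} (hΩ : IsOpen Ω) (hb : Bornology.IsBounded Ω)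
    (hfin : (μH[1] : Measure ℂ) (frontier Ω) < ⊤) {v w : ℂ} {π : ℂ → ℝ} (hfr : IsFrame v w π)
    {F : ℂ → ℂ} (hF : ContDiff ℝ 1 F) :
    ∃ A : ℝ → ℝ≥0∞, Measurable A ∧
      ∫⁻ y, A y ≤ (∫⁻ z in Ω, ‖fderiv ℝ F z v‖ₑ) +
        2 * ∫⁻ z in frontier Ω, ‖F z‖ₑ ∂(μH[1] : Measure ℂ) ∧
      ∀ᵐ y : ℝ, ∀ s : ℝ, ‖Ω.indicator F (s • v + y • w)‖ₑ ≤ A y := by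
  obtain ⟨B, hBm, hBI, hB⟩ := exists_measurable_sum_fiber_le
    (isClosed_frontier (s := Ω)).measurableSet hfr.lipschitz (f := fun z => ‖F z‖ₑ)
    hF.continuous.enorm
  have hcont : Continuous fun z => fderiv ℝ F z v := by
    have := hF.continuous_fderiv (by simp)
    fun_prop
  have hmp := hfr.measurePreserving
  have hmeas : Measurable fun z => ‖Ω.indicator (fun z => fderiv ℝ F z v) z‖ₑ :=
    (hcont.measurable.indicator hΩ.measurableSet).enorm
  have hmeas2 : Measurable fun p : ℝ × ℝ =>
      ‖Ω.indicator (fun z => fderiv ℝ F z v) (p.2 • v + p.1 • w)‖ₑ :=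
    hmeas.comp hmp.measurable
  refine ⟨fun y => (∫⁻ s : ℝ, ‖Ω.indicator (fun z => fderiv ℝ F z v) (s • v + y • w)‖ₑ)
    + 2 * B y, hmeas2.lintegral_prod_right'.add (hBm.const_mul 2), ?_, ?_⟩
  · rw [lintegral_add_right _ (hBm.const_mul 2), lintegral_const_mul _ hBm]
    gcongr
    rw [← lintegral_prod _ hmeas2.aemeasurable, hmp.lintegral_comp hmeas,
      ← lintegral_indicator hΩ.measurableSet]
    refine le_of_eq (lintegral_congr fun z => ?_)
    by_cases hz : z ∈ Ω <;> simp [hz]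
  · filter_upwards [ae_finite_fiber isClosed_frontier.measurableSet hfin hfr.lipschitz]
      with y hy
    exact (enorm_line_le hΩ hb hfr hF hy (hB y)).2

/-- The Gagliardo-Nirenberg inequality with boundary terms. -/
theorem lintegral_enorm_sq_le {Ω : Set ℂ} (hΩ : IsOpen Ω) (hb : Bornology.IsBounded Ω)
    (hfin : (μH[1] : Measure ℂ) (frontier Ω) < ⊤) {F : ℂ → ℂ} (hF : ContDiff ℝ 1 F) :
    ∫⁻ z in Ω, ‖F z‖ₑ ^ 2 ≤
      ((∫⁻ z in Ω, ‖fderiv ℝ F z 1‖ₑ) +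
        2 * ∫⁻ z in frontier Ω, ‖F z‖ₑ ∂(μH[1] : Measure ℂ)) *
      ((∫⁻ z in Ω, ‖fderiv ℝ F z Complex.I‖ₑ) +
        2 * ∫⁻ z in frontier Ω, ‖F z‖ₑ ∂(μH[1] : Measure ℂ)) := by
  obtain ⟨A, hAm, hAI, hA⟩ := exists_measurable_line_bound hΩ hb hfin isFrame_one_I hF
  obtain ⟨A', hAm', hAI', hA'⟩ := exists_measurable_line_bound hΩ hb hfin isFrame_I_one hF
  have hmp := isFrame_I_one.measurePreserving
  have hmeas : Measurable fun z => ‖Ω.indicator F z‖ₑ ^ 2 :=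
    ((hF.continuous.measurable.indicator hΩ.measurableSet).enorm).pow_const 2
  have hmeas2 : Measurable fun p : ℝ × ℝ => ‖Ω.indicator F (p.2 • Complex.I + p.1 • 1)‖ₑ ^ 2 :=
    hmeas.comp hmp.measurable
  calc ∫⁻ z in Ω, ‖F z‖ₑ ^ 2 = ∫⁻ z, ‖Ω.indicator F z‖ₑ ^ 2 := by
        rw [← lintegral_indicator hΩ.measurableSet]
        refine lintegral_congr fun z => ?_
        by_cases hz : z ∈ Ω <;> simp [hz]
    _ = ∫⁻ x : ℝ, ∫⁻ t : ℝ, ‖Ω.indicator F (t • Complex.I + x • 1)‖ₑ ^ 2 := by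
        rw [← hmp.lintegral_comp hmeas, lintegral_prod _ hmeas2.aemeasurable]
    -- One factor |F| is bounded along the vertical line through the point, the other along the
    -- horizontal one.
    _ ≤ ∫⁻ x : ℝ, ∫⁻ t : ℝ, A' x * A t := by
        refine lintegral_mono_ae ?_
        filter_upwards [hA'] with x hx
        refine lintegral_mono_ae ?_
        filter_upwards [hA] with t ht
        rw [sq]
        refine mul_le_mul' (hx t) ?_
        rw [add_comm]
        exact ht x
    _ = (∫⁻ x, A' x) * ∫⁻ t, A t := by
        simp_rw [lintegral_const_mul _ hAm]
        rw [lintegral_mul_const _ hAm']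
    _ ≤ _ := by
        rw [mul_comm]
        gcongr

/-! ### Poincaré's inequality on squares and approximation by step functions. -/

theorem lintegral_mul_sq_le {α : Type*} [MeasurableSpace α] (μ : Measure α) {f g : α → ℝ≥0∞}
    (hf : AEMeasurable f μ) (hg : AEMeasurable g μ) :
    (∫⁻ a, f a * g a ∂μ) ^ 2 ≤ (∫⁻ a, f a ^ 2 ∂μ) * ∫⁻ a, g a ^ 2 ∂μ := by
  have h := ENNReal.lintegral_mul_le_Lp_mul_Lq μ Real.HolderConjugate.two_two hf hg
  simp only [Pi.mul_apply, ENNReal.rpow_two] at h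
  refine (pow_le_pow_left' h 2).trans (le_of_eq ?_)
  rw [mul_pow, ← ENNReal.rpow_two, ← ENNReal.rpow_two, ← ENNReal.rpow_mul, ← ENNReal.rpow_mul]
  norm_num

theorem lintegral_sq_le {α : Type*} [MeasurableSpace α] (μ : Measure α) {f : α → ℝ≥0∞}
    (hf : AEMeasurable f μ) : (∫⁻ a, f a ∂μ) ^ 2 ≤ μ Set.univ * ∫⁻ a, f a ^ 2 ∂μ := by
  have := lintegral_mul_sq_le μ (aemeasurable_const (b := (1 : ℝ≥0∞))) hf
  simpa using this

/-- The half-open interval `[kδ, (k+1)δ)`. -/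
def gridInterval (δ : ℝ) (k : ℤ) : Set ℝ := Set.Ico (k * δ) (k * δ + δ)

theorem mem_gridInterval {δ : ℝ} (hδ : 0 < δ) {k : ℤ} {x : ℝ} :
    x ∈ gridInterval δ k ↔ ⌊x / δ⌋ = k := by
  rw [Int.floor_eq_iff, gridInterval, Set.mem_Ico, le_div_iff₀ hδ, div_lt_iff₀ hδ, add_mul,
    one_mul]

theorem lintegral_gridCell {δ : ℝ} (hδ : 0 < δ) (k : ℤ × ℤ) {h : ℂ → ℝ≥0∞} (hh : Measurable h) :
    ∫⁻ z in gridCell δ k, h z = ∫⁻ x in gridInterval δ k.1, ∫⁻ t in gridInterval δ k.2,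
      h (t • Complex.I + x • 1) := by
  have hmp := isFrame_I_one.measurePreserving
  rw [← hmp.setLIntegral_comp_preimage (measurableSet_gridCell δ k) hh]
  have hpre : (fun p : ℝ × ℝ => (p.2 • Complex.I + p.1 • 1 : ℂ)) ⁻¹' gridCell δ k
      = gridInterval δ k.1 ×ˢ gridInterval δ k.2 := by
    ext p
    simp [gridCell, mem_gridInterval hδ]
  rw [hpre, ← Measure.prod_restrict]
  exact lintegral_prod _ (hh.comp hmp.measurable).aemeasurable

theorem enorm_sub_le_lintegral {s : Set ℝ} (hs : s.OrdConnected) {f f' : ℝ → ℂ}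
    (hf : ∀ x, HasDerivAt f (f' x) x) (hf' : Continuous f') {a b : ℝ} (ha : a ∈ s) (hb : b ∈ s) :
    ‖f b - f a‖ₑ ≤ ∫⁻ x in s, ‖f' x‖ₑ := by
  rw [← intervalIntegral.integral_eq_sub_of_hasDerivAt (fun x _ => hf x)
    (hf'.intervalIntegrable a b), ← ofReal_norm, intervalIntegral.norm_integral_eq_norm_integral_uIoc,
    ofReal_norm]
  exact (enorm_integral_le_lintegral_enorm _).trans
    (lintegral_mono_set (Set.uIoc_subset_uIcc.trans (hs.uIcc_subset ha hb)))

/-- Poincaré's inequality on a square. -/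
theorem exists_lintegral_gridCell_sub_le {δ : ℝ} (hδ : 0 < δ) (k : ℤ × ℤ) {F : ℂ → ℂ}
    (hF : ContDiff ℝ 1 F) : ∃ c : ℂ, ∫⁻ z in gridCell δ k, ‖F z - c‖ₑ ^ 2 ≤
      2 * ENNReal.ofReal δ ^ 2 * ∫⁻ z in gridCell δ k,
        (‖fderiv ℝ F z 1‖ₑ ^ 2 + ‖fderiv ℝ F z Complex.I‖ₑ ^ 2) := by
  set D := ENNReal.ofReal δ with hD
  set S := gridInterval δ k.1 with hS
  set T := gridInterval δ k.2 with hT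
  have hvol : ∀ j, volume (gridInterval δ j) = D := fun j => by
    rw [gridInterval, Real.volume_Ico]; congr 1; ring
  have hD0 : D ≠ 0 := by rw [hD]; simpa using hδ
  have hDt : D ≠ ⊤ := ENNReal.ofReal_ne_top
  have hcF : Continuous (fderiv ℝ F) := hF.continuous_fderiv (by simp)
  have hmx : Measurable fun z => ‖fderiv ℝ F z 1‖ₑ ^ 2 := by
    have : Continuous fun z => fderiv ℝ F z 1 := by fun_prop
    exact this.measurable.enorm.pow_const 2
  have hmy : Measurable fun z => ‖fderiv ℝ F z Complex.I‖ₑ ^ 2 := by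
    have : Continuous fun z => fderiv ℝ F z Complex.I := by fun_prop
    exact this.measurable.enorm.pow_const 2
  have hmp := isFrame_I_one.measurePreserving.measurable
  set g1 : ℝ → ℝ≥0∞ := fun t => ∫⁻ x in S, ‖fderiv ℝ F (t • Complex.I + x • 1) 1‖ₑ ^ 2 with hg1
  set g2 : ℝ → ℝ≥0∞ := fun x =>
    ∫⁻ t in T, ‖fderiv ℝ F (t • Complex.I + x • 1) Complex.I‖ₑ ^ 2 with hg2
  have hg1m : Measurable g1 := Measurable.lintegral_prod_left' (hmx.comp hmp)
  have hg2m : Measurable g2 := Measurable.lintegral_prod_right' (hmy.comp hmp)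
  have hX : ∫⁻ t in T, g1 t = ∫⁻ z in gridCell δ k, ‖fderiv ℝ F z 1‖ₑ ^ 2 := by
    rw [lintegral_gridCell hδ k hmx]
    exact lintegral_lintegral_swap ((hmx.comp hmp).comp measurable_swap).aemeasurable
  have hY : ∫⁻ x in S, g2 x = ∫⁻ z in gridCell δ k, ‖fderiv ℝ F z Complex.I‖ₑ ^ 2 :=
    (lintegral_gridCell hδ k hmy).symm
  -- Choose a vertical segment on which the energy of ∂_yF is at most average. Each point of the
  -- square is joined to (x0, y0) by a horizontal move to this segment, then a vertical one; y0 is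
  -- arbitrary.
  obtain ⟨x0, hx0, hx0le⟩ := exists_le_setLAverage (μ := volume) (s := S) (f := g2)
    (by rw [hS, hvol]; exact hD0) (by rw [hS, hvol]; exact hDt) hg2m.aemeasurable
  rw [setLAverage_eq, hS, hvol, ← hS, hY] at hx0le
  have hy0 : (k.2 : ℝ) * δ ∈ T := ⟨le_rfl, by linarith⟩
  set y0 : ℝ := k.2 * δ with hy0def
  have hoc : ∀ j, (gridInterval δ j).OrdConnected := fun j => Set.ordConnected_Ico
  refine ⟨F (y0 • Complex.I + x0 • 1), ?_⟩
  have hpt : ∀ x ∈ S, ∀ t ∈ T, ‖F (t • Complex.I + x • 1) - F (y0 • Complex.I + x0 • 1)‖ₑ ^ 2 ≤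
      2 * D * g1 t + 2 * D * g2 x0 := by
    intro x hx t ht
    have h1 : ‖F (t • Complex.I + x • 1) - F (t • Complex.I + x0 • 1)‖ₑ ^ 2 ≤ D * g1 t := by
      have hc : Continuous fun s : ℝ => fderiv ℝ F (s • 1 + t • Complex.I) 1 :=
        continuous_fderiv_line hF 1 _
      have := enorm_sub_le_lintegral (hoc k.1) (fun s => hasDerivAt_line hF 1 (t • Complex.I) s)
        hc hx0 hx
      simp only [add_comm _ (t • Complex.I)] at this hc
      refine (pow_le_pow_left' this 2).trans ((lintegral_sq_le _
        hc.measurable.enorm.aemeasurable).trans ?_)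
      rw [Measure.restrict_apply_univ, hvol]
    have h2 : ‖F (t • Complex.I + x0 • 1) - F (y0 • Complex.I + x0 • 1)‖ₑ ^ 2 ≤ D * g2 x0 := by
      have hc := continuous_fderiv_line hF Complex.I (x0 • 1)
      have := enorm_sub_le_lintegral (hoc k.2)
        (fun s => hasDerivAt_line hF Complex.I (x0 • 1) s) hc hy0 ht
      refine (pow_le_pow_left' this 2).trans ((lintegral_sq_le _
        hc.measurable.enorm.aemeasurable).trans ?_)
      rw [Measure.restrict_apply_univ, hvol]
    have h3 : ‖F (t • Complex.I + x • 1) - F (y0 • Complex.I + x0 • 1)‖ₑ ≤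
        ‖F (t • Complex.I + x • 1) - F (t • Complex.I + x0 • 1)‖ₑ +
        ‖F (t • Complex.I + x0 • 1) - F (y0 • Complex.I + x0 • 1)‖ₑ := by
      refine le_trans (le_of_eq ?_) (enorm_add_le _ _)
      congr 1; abel
    have h4 : ∀ a b : ℝ≥0∞, (a + b) ^ 2 ≤ 2 * (a ^ 2 + b ^ 2) := fun a b => by
      have := ENNReal.rpow_add_le_mul_rpow_add_rpow a b (p := 2) (by norm_num)
      norm_num at this
      exact this
    calc _ ≤ _ := pow_le_pow_left' h3 2
      _ ≤ _ := h4 _ _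
      _ ≤ 2 * (D * g1 t + D * g2 x0) := by gcongr
      _ = _ := by ring
  have hFm : Measurable fun z => ‖F z - F (y0 • Complex.I + x0 • 1)‖ₑ ^ 2 :=
    (hF.continuous.measurable.sub_const _).enorm.pow_const 2
  rw [lintegral_gridCell hδ k hFm]
  calc _ ≤ ∫⁻ x in S, ∫⁻ t in T, (2 * D * g1 t + 2 * D * g2 x0) := by
        refine setLIntegral_mono' measurableSet_Ico fun x hx => ?_
        exact setLIntegral_mono' measurableSet_Ico fun t ht => hpt x hx t ht
    _ = D * (2 * D * (∫⁻ t in T, g1 t) + 2 * D * g2 x0 * D) := by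
        rw [lintegral_const, Measure.restrict_apply_univ, hvol,
          lintegral_add_right _ measurable_const, lintegral_const_mul _ hg1m, lintegral_const,
          Measure.restrict_apply_univ, hvol, mul_comm]
    _ ≤ D * (2 * D * (∫⁻ t in T, g1 t) +
        2 * D * ((∫⁻ z in gridCell δ k, ‖fderiv ℝ F z Complex.I‖ₑ ^ 2) / D) * D) := by gcongr
    _ = D * (2 * D * (∫⁻ t in T, g1 t) +
        2 * D * (∫⁻ z in gridCell δ k, ‖fderiv ℝ F z Complex.I‖ₑ ^ 2)) := by
        rw [mul_assoc (2 * D), ENNReal.div_mul_cancel hD0 hDt]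
    _ = _ := by
        rw [hX, lintegral_add_left hmx]; ring

/-- Functions with bounded energy and bounded `L⁴` norm are uniformly close, in `L²`, to a finite
dimensional space of step functions. -/
theorem exists_finiteDimensional_approx {Ω : Set ℂ} (hΩ : IsOpen Ω) (hb : Bornology.IsBounded Ω)
    (M : NNReal) {ε : NNReal} (hε : 0 < ε) :
    ∃ E : Submodule ℂ (Lp ℂ 2 (volume.restrict Ω)), FiniteDimensional ℂ E ∧
      ∀ F : ℂ → ℂ, ContDiff ℝ 1 F → ∫⁻ z in Ω, ‖fderiv ℝ F z 1‖ₑ ^ 2 ≤ M →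
        ∫⁻ z in Ω, ‖fderiv ℝ F z Complex.I‖ₑ ^ 2 ≤ M → ∫⁻ z in Ω, ‖F z‖ₑ ^ 4 ≤ M →
        ∃ f ∈ E, ∫⁻ z in Ω, ‖F z - f z‖ₑ ^ 2 ≤ ε := by
  classical
  -- Half of the error is for the cells meeting K, half for the thin remainder of Ω.
  set η : NNReal := ε / 2 with hη
  have hη0 : 0 < η := by positivity
  have hMη : 0 < η ^ 2 / (M + 1) := by positivity
  -- With ∫|F|⁴ ≤ M, Cauchy–Schwarz on a set of measure below η²/(M+1) gives ∫|F|² ≤ η.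
  obtain ⟨K, hKΩ, hK, hKlt⟩ := hΩ.measurableSet.exists_isCompact_sdiff_lt
    (μ := volume) hb.measure_lt_top.ne (ε := ((η ^ 2 / (M + 1) : NNReal) : ℝ≥0∞))
    (by exact_mod_cast hMη.ne')
  obtain ⟨r, hr, hrΩ⟩ := hK.exists_cthickening_subset_open hΩ hKΩ
  -- Cells have diameter at most 2δ ≤ r, so those touching K stay in Ω; the second bound makes the
  -- summed Poincaré error 4Mδ² at most η.
  set δ : ℝ := min (r / 2) (Real.sqrt (η / (4 * (M + 1)))) with hδdef
  have hδ : 0 < δ := lt_min (by positivity) (Real.sqrt_pos.2 (by positivity))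
  have hδ2 : δ ^ 2 ≤ η / (4 * (M + 1)) := by
    rw [← Real.sq_sqrt (show (0 : ℝ) ≤ η / (4 * (M + 1)) by positivity)]
    exact pow_le_pow_left₀ hδ.le (min_le_right _ _) 2
  obtain ⟨R, hR⟩ := hK.isBounded.exists_norm_le
  set N : ℤ := ⌈R / δ⌉ + 1 with hN
  set I : Finset (ℤ × ℤ) := (Finset.Icc (-N) N ×ˢ Finset.Icc (-N) N).filter
    fun k => (gridCell δ k ∩ K).Nonempty with hI
  have hcover : K ⊆ ⋃ k ∈ I, gridCell δ k := by
    intro z hz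
    have hb1 : ∀ x : ℝ, |x| ≤ R → ⌊x / δ⌋ ∈ Finset.Icc (-N) N := by
      intro x hx
      obtain ⟨h1, h2⟩ := abs_le.1 hx
      have h3 : x / δ ≤ R / δ := by gcongr
      have h4 : -(R / δ) ≤ x / δ := by rw [← neg_div]; gcongr
      have h5 := Int.le_ceil (R / δ)
      rw [Finset.mem_Icc]
      constructor
      · rw [Int.le_floor, hN]; push_cast; linarith
      · have : ⌊x / δ⌋ ≤ ⌈R / δ⌉ := by
          have : (⌊x / δ⌋ : ℝ) ≤ ⌈R / δ⌉ := (Int.floor_le _).trans (h3.trans h5)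
          exact_mod_cast this
        omega
    refine Set.mem_iUnion₂.2 ⟨(⌊z.re / δ⌋, ⌊z.im / δ⌋), ?_, rfl, rfl⟩
    refine Finset.mem_filter.2 ⟨Finset.mem_product.2 ⟨?_, ?_⟩, z, ⟨rfl, rfl⟩, hz⟩
    · exact hb1 _ ((Complex.abs_re_le_norm z).trans (hR z hz))
    · exact hb1 _ ((Complex.abs_im_le_norm z).trans (hR z hz))
  have hcell : ∀ k ∈ I, gridCell δ k ⊆ Ω := by
    intro k hk z hz
    obtain ⟨w, hw, hwK⟩ := (Finset.mem_filter.1 hk).2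
    refine hrΩ (Metric.mem_cthickening_of_dist_le z w r K hwK ?_)
    refine (dist_le_of_mem_gridCell hδ hz hw).trans ?_
    have := min_le_left (r / 2) (Real.sqrt (η / (4 * (M + 1))))
    linarith
  have hfinite : ∀ k, (volume.restrict Ω) (gridCell δ k) ≠ ⊤ := fun k => by
    rw [Measure.restrict_apply (measurableSet_gridCell δ k)]
    exact ((measure_mono Set.inter_subset_right).trans_lt hb.measure_lt_top).ne
  set u : ℤ × ℤ → Lp ℂ 2 (volume.restrict Ω) := fun k =>
    indicatorConstLp 2 (measurableSet_gridCell δ k) (hfinite k) (1 : ℂ) with hu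
  refine ⟨Submodule.span ℂ (u '' I), FiniteDimensional.span_of_finite ℂ
    (I.finite_toSet.image u), fun F hF hX hY h4 => ?_⟩
  -- Only the coefficients depend on F; the cells, hence the subspace, do not.
  choose c hc using fun k => exists_lintegral_gridCell_sub_le hδ k hF
  refine ⟨∑ k ∈ I, c k • u k, Submodule.sum_mem _ fun k hk => Submodule.smul_mem _ _
    (Submodule.subset_span ⟨k, hk, rfl⟩), ?_⟩
  set g : ℂ → ℂ := fun z => ∑ k ∈ I, (gridCell δ k).indicator (fun _ => c k) z with hg
  have hfg : (∑ k ∈ I, c k • u k : Lp ℂ 2 (volume.restrict Ω)) =ᵐ[volume.restrict Ω] g := by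
    have h1 : ∀ k ∈ I, ∀ᵐ z ∂(volume.restrict Ω),
        (c k • u k : Lp ℂ 2 (volume.restrict Ω)) z = (gridCell δ k).indicator (fun _ => c k) z := by
      intro k _
      filter_upwards [Lp.coeFn_smul (c k) (u k), indicatorConstLp_coeFn (p := 2)
        (hs := measurableSet_gridCell δ k) (hμs := hfinite k) (c := (1 : ℂ))] with z hz1 hz2
      rw [hz1, Pi.smul_apply, hz2]
      by_cases hz : z ∈ gridCell δ k <;> simp [hz]
    filter_upwards [Lp.coeFn_finsetSum I fun k => c k • u k,
      (Finset.eventually_all I).2 h1] with z hz1 hz2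
    rw [hz1, Finset.sum_apply]
    exact Finset.sum_congr rfl hz2
  rw [lintegral_congr_ae (g := fun z => ‖F z - g z‖ₑ ^ 2)
    (hfg.mono fun z hz => by simp only [hz])]
  set U : Set ℂ := ⋃ k ∈ I, gridCell δ k with hU
  have hUm : MeasurableSet U := I.measurableSet_biUnion fun k _ => measurableSet_gridCell δ k
  have hUΩ : U ⊆ Ω := Set.iUnion₂_subset hcell
  have hdisj : Set.PairwiseDisjoint (I : Set (ℤ × ℤ)) (gridCell δ) :=
    (pairwise_disjoint_gridCell δ).set_pairwise _
  have hgin : ∀ k ∈ I, ∀ z ∈ gridCell δ k, g z = c k := by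
    intro k hk z hz
    simp only [hg]
    rw [Finset.sum_eq_single_of_mem k hk, Set.indicator_of_mem hz]
    intro l _ hlk
    exact Set.indicator_of_notMem (fun h => (pairwise_disjoint_gridCell δ hlk).le_bot ⟨h, hz⟩) _
  have hgout : ∀ z ∉ U, g z = 0 := by
    intro z hz
    refine Finset.sum_eq_zero fun k hk => Set.indicator_of_notMem (fun h => hz ?_) _
    exact Set.mem_iUnion₂.2 ⟨k, hk, h⟩
  have hFm : Measurable fun z => ‖F z‖ₑ := hF.continuous.measurable.enorm
  have hcF : Continuous (fderiv ℝ F) := hF.continuous_fderiv (by simp)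
  have hmx : Measurable fun z => ‖fderiv ℝ F z 1‖ₑ ^ 2 := by
    have : Continuous fun z => fderiv ℝ F z 1 := by fun_prop
    exact this.measurable.enorm.pow_const 2
  have hin : ∫⁻ z in U, ‖F z - g z‖ₑ ^ 2 ≤ η := by
    rw [hU, lintegral_biUnion_finset hdisj fun k _ => measurableSet_gridCell δ k]
    calc ∑ k ∈ I, ∫⁻ z in gridCell δ k, ‖F z - g z‖ₑ ^ 2
        ≤ ∑ k ∈ I, 2 * ENNReal.ofReal δ ^ 2 * ∫⁻ z in gridCell δ k,
        (‖fderiv ℝ F z 1‖ₑ ^ 2 + ‖fderiv ℝ F z Complex.I‖ₑ ^ 2) := by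
          refine Finset.sum_le_sum fun k hk => le_trans (le_of_eq ?_) (hc k)
          exact setLIntegral_congr_fun (measurableSet_gridCell δ k)
            fun z hz => by simp only [hgin k hk z hz]
      _ = 2 * ENNReal.ofReal δ ^ 2 * ∫⁻ z in U,
        (‖fderiv ℝ F z 1‖ₑ ^ 2 + ‖fderiv ℝ F z Complex.I‖ₑ ^ 2) := by
          rw [← Finset.mul_sum, hU,
            lintegral_biUnion_finset hdisj fun k _ => measurableSet_gridCell δ k]
      _ ≤ 2 * ENNReal.ofReal δ ^ 2 * (M + M) := by
          gcongr
          refine (lintegral_mono_set hUΩ).trans ?_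
          rw [lintegral_add_left hmx]
          exact add_le_add hX hY
      _ = ENNReal.ofReal (2 * δ ^ 2 * (M + M)) := by
          rw [ENNReal.ofReal_mul (by positivity), ENNReal.ofReal_mul (by positivity),
            ENNReal.ofReal_pow hδ.le, ENNReal.ofReal_add M.coe_nonneg M.coe_nonneg, ENNReal.ofReal_coe_nnreal]
          simp
      _ ≤ η := by
          rw [← ENNReal.ofReal_coe_nnreal]
          apply ENNReal.ofReal_le_ofReal
          rw [le_div_iff₀ (by positivity)] at hδ2
          nlinarith [sq_nonneg δ]
  have hout : ∫⁻ z in Ω \ U, ‖F z - g z‖ₑ ^ 2 ≤ η := by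
    have h1 : ∫⁻ z in Ω \ U, ‖F z - g z‖ₑ ^ 2 ≤ ∫⁻ z in Ω \ K, ‖F z‖ₑ ^ 2 := by
      calc _ = ∫⁻ z in Ω \ U, ‖F z‖ₑ ^ 2 := setLIntegral_congr_fun
            (hΩ.measurableSet.diff hUm) fun z hz => by simp only [hgout z hz.2, sub_zero]
        _ ≤ _ := lintegral_mono_set (Set.sdiff_subset_sdiff_right hcover)
    refine h1.trans ((ENNReal.pow_right_strictMono (n := 2) two_ne_zero).le_iff_le.1 ?_)
    calc (∫⁻ z in Ω \ K, ‖F z‖ₑ ^ 2) ^ 2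
        ≤ volume (Ω \ K) * ∫⁻ z in Ω \ K, ‖F z‖ₑ ^ 4 := by
          have := lintegral_sq_le (volume.restrict (Ω \ K)) (hFm.pow_const 2).aemeasurable
          simpa [← pow_mul] using this
      _ ≤ ((η ^ 2 / (M + 1) : NNReal) : ℝ≥0∞) * M := by
          gcongr
          exact (lintegral_mono_set Set.sdiff_subset).trans h4
      _ ≤ (η : ℝ≥0∞) ^ 2 := by
          rw [← ENNReal.coe_mul, ← ENNReal.coe_pow, ENNReal.coe_le_coe, div_mul_eq_mul_div]
          exact div_le_of_le_mul₀ (by positivity) (by positivity) (by gcongr; simp)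
  calc ∫⁻ z in Ω, ‖F z - g z‖ₑ ^ 2
      = (∫⁻ z in Ω ∩ U, ‖F z - g z‖ₑ ^ 2) + ∫⁻ z in Ω \ U, ‖F z - g z‖ₑ ^ 2 :=
        (lintegral_inter_add_sdiff _ _ hUm).symm
    _ ≤ η + η := by
        rw [Set.inter_eq_self_of_subset_right hUΩ]
        exact add_le_add hin hout
    _ = ε := by rw [← ENNReal.coe_add, hη, add_halves]

/-! ### The graph of the trace operator. -/

/-- A bounded open set with boundary of finite length. -/
structure HasRectifiableBoundary (Ω : Set ℂ) : Prop where
  isOpen : IsOpen Ω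
  isBounded : Bornology.IsBounded Ω
  finite : (μH[1] : Measure ℂ) (frontier Ω) < ⊤

theorem IsSmoothBoundedDomain.hasRectifiableBoundary {Ω : Set ℂ} (h : IsSmoothBoundedDomain Ω) :
    HasRectifiableBoundary Ω :=
  ⟨h.isOpen, h.isBounded, h.hausdorffMeasure_frontier_lt_top⟩

theorem memLp_restrict_of_continuous {μ : Measure ℂ} {s : Set ℂ} (hs : MeasurableSet s)
    (hb : Bornology.IsBounded s) (hμ : μ s < ⊤) {h : ℂ → ℂ} (hh : Continuous h) :
    MemLp h 2 (μ.restrict s) := by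
  have : IsFiniteMeasure (μ.restrict s) := ⟨by rwa [Measure.restrict_apply_univ]⟩
  obtain ⟨C, hC⟩ := (hb.isCompact_closure.image hh).isBounded.exists_norm_le
  refine MemLp.of_bound hh.aestronglyMeasurable C ?_
  filter_upwards [ae_restrict_mem hs] with z hz
  exact hC _ ⟨z, subset_closure hz, rfl⟩

theorem HasRectifiableBoundary.memLp {Ω : Set ℂ} (h : HasRectifiableBoundary Ω) {f : ℂ → ℂ}
    (hf : Continuous f) : MemLp f 2 (volume.restrict Ω) :=
  memLp_restrict_of_continuous h.isOpen.measurableSet h.isBounded h.isBounded.measure_lt_top hf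

theorem HasRectifiableBoundary.memLp_bdry {Ω : Set ℂ} (h : HasRectifiableBoundary Ω) {f : ℂ → ℂ}
    (hf : Continuous f) : MemLp f 2 (bdryMeasure Ω) :=
  memLp_restrict_of_continuous isClosed_frontier.measurableSet
    (h.isBounded.closure.subset frontier_subset_closure) h.finite hf

/-- Quadruples consisting of a function, two partial derivatives and a boundary value. -/
abbrev GraphSpace (Ω : Set ℂ) : Type :=
  Lp ℂ 2 (volume.restrict Ω) × Lp ℂ 2 (volume.restrict Ω) × Lp ℂ 2 (volume.restrict Ω) ×
    Lp ℂ 2 (bdryMeasure Ω)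

theorem contDiff_fderiv_apply {φ : ℂ → ℂ} (hφ : ContDiff ℝ ∞ φ) (v : ℂ) :
    ContDiff ℝ ∞ fun z => fderiv ℝ φ z v :=
  (hφ.fderiv_right (m := ∞) (by simp)).clm_apply contDiff_const

theorem continuous_fderiv_apply {φ : ℂ → ℂ} (hφ : ContDiff ℝ ∞ φ) (v : ℂ) :
    Continuous fun z => fderiv ℝ φ z v := (contDiff_fderiv_apply hφ v).continuous

/-- The function, the partial derivatives and the boundary values of a smooth function. -/
def toGraph {Ω : Set ℂ} (h : HasRectifiableBoundary Ω) {φ : ℂ → ℂ} (hφ : ContDiff ℝ ∞ φ) :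
    GraphSpace Ω :=
  ((h.memLp hφ.continuous).toLp φ, (h.memLp (continuous_fderiv_apply hφ 1)).toLp _,
    (h.memLp (continuous_fderiv_apply hφ Complex.I)).toLp _,
    (h.memLp_bdry hφ.continuous).toLp φ)

theorem toGraph_add {Ω : Set ℂ} (h : HasRectifiableBoundary Ω) {φ ψ : ℂ → ℂ}
    (hφ : ContDiff ℝ ∞ φ) (hψ : ContDiff ℝ ∞ ψ) :
    toGraph h (φ := φ + ψ) (hφ.add hψ) = toGraph h hφ + toGraph h hψ := by
  have hd : ∀ v, (fun z => fderiv ℝ (φ + ψ) z v) =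
      (fun z => fderiv ℝ φ z v) + fun z => fderiv ℝ ψ z v := fun v => by
    funext z
    rw [fderiv_add (hφ.differentiable (by simp) z) (hψ.differentiable (by simp) z)]
    rfl
  refine Prod.ext ?_ (Prod.ext ?_ (Prod.ext ?_ ?_))
  · exact MemLp.toLp_add (h.memLp hφ.continuous) (h.memLp hψ.continuous)
  · simp only [toGraph, hd]
    exact MemLp.toLp_add (h.memLp (continuous_fderiv_apply hφ 1))
      (h.memLp (continuous_fderiv_apply hψ 1))
  · simp only [toGraph, hd]
    exact MemLp.toLp_add (h.memLp (continuous_fderiv_apply hφ Complex.I))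
      (h.memLp (continuous_fderiv_apply hψ Complex.I))
  · exact MemLp.toLp_add (h.memLp_bdry hφ.continuous) (h.memLp_bdry hψ.continuous)

theorem toGraph_smul {Ω : Set ℂ} (h : HasRectifiableBoundary Ω) {φ : ℂ → ℂ}
    (hφ : ContDiff ℝ ∞ φ) (c : ℝ) :
    toGraph h (φ := c • φ) (contDiff_const.smul hφ) = c • toGraph h hφ := by
  have hd : ∀ v, (fun z => fderiv ℝ (c • φ) z v) = c • (fun z => fderiv ℝ φ z v) := fun v => by
    funext z
    rw [fderiv_const_smul (hφ.differentiable (by simp) z)]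
    rfl
  refine Prod.ext ?_ (Prod.ext ?_ (Prod.ext ?_ ?_))
  · exact MemLp.toLp_const_smul c (h.memLp hφ.continuous)
  · simp only [toGraph, hd]
    exact MemLp.toLp_const_smul c (h.memLp (continuous_fderiv_apply hφ 1))
  · simp only [toGraph, hd]
    exact MemLp.toLp_const_smul c (h.memLp (continuous_fderiv_apply hφ Complex.I))
  · exact MemLp.toLp_const_smul c (h.memLp_bdry hφ.continuous)

/-- The graphs of smooth functions. -/
def smoothGraph {Ω : Set ℂ} (h : HasRectifiableBoundary Ω) : Submodule ℝ (GraphSpace Ω) where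
  carrier := {p | ∃ (φ : ℂ → ℂ) (hφ : ContDiff ℝ ∞ φ), toGraph h hφ = p}
  add_mem' := by
    rintro _ _ ⟨φ, hφ, rfl⟩ ⟨ψ, hψ, rfl⟩
    exact ⟨φ + ψ, hφ.add hψ, toGraph_add h hφ hψ⟩
  zero_mem' :=
    ⟨(0 : ℝ) • fun _ => 0, contDiff_const.smul contDiff_const, by
      exact (toGraph_smul h contDiff_const 0).trans (zero_smul _ _)⟩
  smul_mem' := by
    rintro c _ ⟨φ, hφ, rfl⟩
    exact ⟨c • φ, contDiff_const.smul hφ, toGraph_smul h hφ c⟩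

theorem mem_smoothGraph {Ω : Set ℂ} {h : HasRectifiableBoundary Ω} {p : GraphSpace Ω} :
    p ∈ smoothGraph h ↔ ∃ (φ : ℂ → ℂ) (hφ : ContDiff ℝ ∞ φ), toGraph h hφ = p := Iff.rfl

/-- The graph of the trace operator on `H¹`. -/
def traceGraph {Ω : Set ℂ} (h : HasRectifiableBoundary Ω) : Submodule ℝ (GraphSpace Ω) :=
  (smoothGraph h).topologicalClosure

theorem toGraph_mem {Ω : Set ℂ} (h : HasRectifiableBoundary Ω) {φ : ℂ → ℂ}
    (hφ : ContDiff ℝ ∞ φ) : toGraph h hφ ∈ traceGraph h :=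
  (smoothGraph h).le_topologicalClosure (mem_smoothGraph.2 ⟨φ, hφ, rfl⟩)

/-- Induction principle: closed properties of smooth graphs hold on the trace graph. -/
theorem traceGraph_induction {Ω : Set ℂ} {h : HasRectifiableBoundary Ω} {P : GraphSpace Ω → Prop}
    (hcl : IsClosed {p | P p}) (hsm : ∀ (φ : ℂ → ℂ) (hφ : ContDiff ℝ ∞ φ), P (toGraph h hφ))
    {p : GraphSpace Ω} (hp : p ∈ traceGraph h) : P p := by
  have hsub : (smoothGraph h : Set (GraphSpace Ω)) ⊆ {p | P p} := by
    intro q hq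
    obtain ⟨φ, hφ, rfl⟩ := mem_smoothGraph.1 hq
    exact hsm φ hφ
  exact closure_minimal hsub hcl hp

/-! ### L² pairings, integration by parts, the Jacobian and Poincaré's inequality. -/

theorem enorm_Lp_sq {α : Type*} [MeasurableSpace α] {μ : Measure α} (f : Lp ℂ 2 μ) :
    ‖f‖ₑ ^ 2 = ∫⁻ z, ‖f z‖ₑ ^ 2 ∂μ := by
  rw [Lp.enorm_def, eLpNorm_eq_lintegral_rpow_enorm_toReal two_ne_zero ENNReal.ofNat_ne_top,
    ← ENNReal.rpow_two, ← ENNReal.rpow_mul]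
  simp

theorem lintegral_toLp_sq {α : Type*} [MeasurableSpace α] {μ : Measure α} {f : α → ℂ}
    (hf : MemLp f 2 μ) : ∫⁻ z, ‖f z‖ₑ ^ 2 ∂μ = ‖hf.toLp f‖ₑ ^ 2 := by
  rw [enorm_Lp_sq]
  exact lintegral_congr_ae (hf.coeFn_toLp.mono fun z hz => by simp only [hz])

theorem lintegral_toLp_mul_le {α : Type*} [MeasurableSpace α] {μ : Measure α} {f g : α → ℂ}
    (hf : MemLp f 2 μ) (hg : MemLp g 2 μ) :
    ∫⁻ z, ‖f z‖ₑ * ‖g z‖ₑ ∂μ ≤ ‖hf.toLp f‖ₑ * ‖hg.toLp g‖ₑ := by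
  refine (ENNReal.pow_right_strictMono (n := 2) two_ne_zero).le_iff_le.1 ?_
  rw [mul_pow, ← lintegral_toLp_sq, ← lintegral_toLp_sq]
  exact lintegral_mul_sq_le μ hf.1.enorm hg.1.enorm

theorem inner_toLp {α : Type*} [MeasurableSpace α] {μ : Measure α} {f g : α → ℂ}
    (hf : MemLp f 2 μ) (hg : MemLp g 2 μ) :
    inner ℂ (hf.toLp f) (hg.toLp g) = ∫ z, g z * conj (f z) ∂μ := by
  rw [L2.inner_def]
  refine integral_congr_ae ?_
  filter_upwards [hf.coeFn_toLp, hg.coeFn_toLp] with z h1 h2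
  rw [h1, h2, RCLike.inner_apply]

theorem integrable_mul_conj {α : Type*} [MeasurableSpace α] {μ : Measure α} {f g : α → ℂ}
    (hf : MemLp f 2 μ) (hg : MemLp g 2 μ) : Integrable (fun z => g z * conj (f z)) μ := by
  have := L2.integrable_inner (𝕜 := ℂ) (hf.toLp f) (hg.toLp g)
  refine this.congr ?_
  filter_upwards [hf.coeFn_toLp, hg.coeFn_toLp] with z h1 h2
  rw [h1, h2, RCLike.inner_apply]

theorem contDiff_conj_comp {n : ℕ∞ω} {φ : ℂ → ℂ} (hφ : ContDiff ℝ n φ) :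
    ContDiff ℝ n fun z => conj (φ z) :=
  Complex.conjCLE.contDiff.comp hφ

theorem fderiv_conj_comp {φ : ℂ → ℂ} {z : ℂ} (hφ : DifferentiableAt ℝ φ z) (v : ℂ) :
    fderiv ℝ (fun z => conj (φ z)) z v = conj (fderiv ℝ φ z v) := by
  have := (Complex.conjCLE.toContinuousLinearMap.hasFDerivAt (x := φ z)).comp z hφ.hasFDerivAt
  have h2 : HasFDerivAt (fun z => conj (φ z)) _ z := this
  rw [h2.fderiv]
  rfl

/-- The integration by parts formula, as an inequality controlling the boundary term. -/
theorem norm_inner_toLp_add_le {Ω : Set ℂ} (h : HasRectifiableBoundary Ω) {φ ψ : ℂ → ℂ}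
    (hφ : ContDiff ℝ ∞ φ) (hψ : ContDiff ℝ ∞ ψ) {v w : ℂ} {π : ℂ → ℝ} (hfr : IsFrame v w π) :
    ‖inner ℂ ((h.memLp hψ.continuous).toLp ψ)
        ((h.memLp (continuous_fderiv_apply hφ v)).toLp _) +
      inner ℂ ((h.memLp (continuous_fderiv_apply hψ v)).toLp _)
        ((h.memLp hφ.continuous).toLp φ)‖ ≤
      2 * (‖(h.memLp_bdry hφ.continuous).toLp φ‖ * ‖(h.memLp_bdry hψ.continuous).toLp ψ‖) := by
  rw [inner_toLp, inner_toLp, ← integral_add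
    (integrable_mul_conj (h.memLp hψ.continuous) (h.memLp (continuous_fderiv_apply hφ v)))
    (integrable_mul_conj (h.memLp (continuous_fderiv_apply hψ v)) (h.memLp hφ.continuous))]
  have hF : ContDiff ℝ ∞ fun z => φ z * conj (ψ z) := hφ.mul (contDiff_conj_comp hψ)
  have hder : ∀ z, fderiv ℝ φ z v * conj (ψ z) + φ z * conj (fderiv ℝ ψ z v) =
      fderiv ℝ (fun z => φ z * conj (ψ z)) z v := by
    intro z
    have h1 := hφ.differentiable (by simp) z
    have h2 := hψ.differentiable (by simp) z
    rw [fderiv_fun_mul h1 ((contDiff_conj_comp hψ).differentiable (by simp) z)]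
    simp only [add_apply, smul_apply, smul_eq_mul]
    rw [fderiv_conj_comp h2]
    ring
  simp only [hder]
  have hG := enorm_setIntegral_fderiv_le h.isOpen h.isBounded h.finite hfr
    (hF.of_le (by simp) : ContDiff ℝ 1 _)
  have hH : ∫⁻ z in frontier Ω, ‖φ z * conj (ψ z)‖ₑ ∂(μH[1] : Measure ℂ) ≤
      ‖(h.memLp_bdry hφ.continuous).toLp φ‖ₑ * ‖(h.memLp_bdry hψ.continuous).toLp ψ‖ₑ := by
    rw [← bdryMeasure]
    simpa only [enorm_mul, RCLike.enorm_conj] using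
      lintegral_toLp_mul_le (h.memLp_bdry hφ.continuous) (h.memLp_bdry hψ.continuous)
  have := hG.trans (mul_le_mul_right hH 2)
  have h2 : ∀ x : ℝ, 2 * ENNReal.ofReal x = ENNReal.ofReal (2 * x) := fun x => by
    rw [ENNReal.ofReal_mul zero_le_two, ENNReal.ofReal_ofNat]
  rw [← ofReal_norm, ← ofReal_norm, ← ofReal_norm, ← ENNReal.ofReal_mul (norm_nonneg _), h2]
    at this
  exact (ENNReal.ofReal_le_ofReal_iff (by positivity)).1 this

/-- Both sides are continuous in p and in q, so the smooth estimate survives the closure. When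
either trace vanishes it is exact integration by parts. -/
theorem norm_inner_add_dx_le {Ω : Set ℂ} {h : HasRectifiableBoundary Ω} {p q : GraphSpace Ω}
    (hp : p ∈ traceGraph h) (hq : q ∈ traceGraph h) :
    ‖inner ℂ q.1 p.2.1 + inner ℂ q.2.1 p.1‖ ≤ 2 * (‖p.2.2.2‖ * ‖q.2.2.2‖) := by
  refine traceGraph_induction (h := h)
    (P := fun p => ‖inner ℂ q.1 p.2.1 + inner ℂ q.2.1 p.1‖ ≤ 2 * (‖p.2.2.2‖ * ‖q.2.2.2‖))
    (isClosed_le (by fun_prop) (by fun_prop)) (fun φ hφ => ?_) hp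
  refine traceGraph_induction (h := h)
    (P := fun q => ‖inner ℂ q.1 (toGraph h hφ).2.1 + inner ℂ q.2.1 (toGraph h hφ).1‖ ≤
      2 * (‖(toGraph h hφ).2.2.2‖ * ‖q.2.2.2‖))
    (isClosed_le (by fun_prop) (by fun_prop)) (fun ψ hψ => ?_) hq
  exact norm_inner_toLp_add_le h hφ hψ isFrame_one_I

theorem norm_inner_add_dy_le {Ω : Set ℂ} {h : HasRectifiableBoundary Ω} {p q : GraphSpace Ω}
    (hp : p ∈ traceGraph h) (hq : q ∈ traceGraph h) :
    ‖inner ℂ q.1 p.2.2.1 + inner ℂ q.2.2.1 p.1‖ ≤ 2 * (‖p.2.2.2‖ * ‖q.2.2.2‖) := by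
  refine traceGraph_induction (h := h)
    (P := fun p => ‖inner ℂ q.1 p.2.2.1 + inner ℂ q.2.2.1 p.1‖ ≤ 2 * (‖p.2.2.2‖ * ‖q.2.2.2‖))
    (isClosed_le (by fun_prop) (by fun_prop)) (fun φ hφ => ?_) hp
  refine traceGraph_induction (h := h)
    (P := fun q => ‖inner ℂ q.1 (toGraph h hφ).2.2.1 + inner ℂ q.2.2.1 (toGraph h hφ).1‖ ≤
      2 * (‖(toGraph h hφ).2.2.2‖ * ‖q.2.2.2‖))
    (isClosed_le (by fun_prop) (by fun_prop)) (fun ψ hψ => ?_) hq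
  exact norm_inner_toLp_add_le h hφ hψ isFrame_I_one

/-- The Jacobian is a null Lagrangian. -/
theorem inner_dx_dy_im_eq_zero {Ω : Set ℂ} {h : HasRectifiableBoundary Ω} {p : GraphSpace Ω}
    (hp : p ∈ traceGraph h) (hp0 : p.2.2.2 = 0) : (inner ℂ p.2.1 p.2.2.1).im = 0 := by
  -- For smooth ψ, integrate p by parts against ∂_yψ in x and against ∂ₓψ in y: the mixed second
  -- derivatives of ψ agree, and only the trace of p has to vanish. By density ψ may then be
  -- replaced by p, which says that the pairing equals its conjugate.
  have key : inner ℂ p.2.2.1 p.2.1 = inner ℂ p.2.1 p.2.2.1 := by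
    refine traceGraph_induction (h := h)
      (P := fun q => inner ℂ q.2.2.1 p.2.1 = inner ℂ q.2.1 p.2.2.1)
      (isClosed_eq (by fun_prop) (by fun_prop)) (fun ψ hψ => ?_) hp
    have h1 := norm_inner_add_dx_le hp (toGraph_mem h (contDiff_fderiv_apply hψ Complex.I))
    have h2 := norm_inner_add_dy_le hp (toGraph_mem h (contDiff_fderiv_apply hψ 1))
    rw [hp0, norm_zero, zero_mul, mul_zero, norm_le_zero_iff] at h1 h2
    have hsymm : (toGraph h (contDiff_fderiv_apply hψ Complex.I)).2.1 =
        (toGraph h (contDiff_fderiv_apply hψ 1)).2.2.1 := by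
      simp only [toGraph]
      congr 1
      funext z
      have hd : DifferentiableAt ℝ (fderiv ℝ ψ) z :=
        (hψ.fderiv_right (m := ∞) (by simp)).differentiable (by simp) z
      rw [fderiv_clm_apply hd (differentiableAt_const _),
        fderiv_clm_apply hd (differentiableAt_const _)]
      have hs : IsSymmSndFDerivAt ℝ ψ z :=
        (contDiff_infty.1 hψ 2).contDiffAt.isSymmSndFDerivAt (by simp)
      simpa using hs.eq 1 Complex.I
    have h3 := h1.trans h2.symm
    rw [hsymm] at h3
    exact add_right_cancel h3
  have := congrArg Complex.im key
  rw [← inner_conj_symm, Complex.conj_im] at this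
  linarith

/-- Poincaré's inequality for functions with vanishing trace, with the boundary term. -/
theorem exists_norm_sq_le {Ω : Set ℂ} (h : HasRectifiableBoundary Ω) :
    ∃ C : ℝ, 0 ≤ C ∧ ∀ p ∈ traceGraph h, ‖p.1‖ ^ 2 ≤ C * (‖p.1‖ * ‖p.2.1‖ + ‖p.2.2.2‖ ^ 2) := by
  obtain ⟨R, hR⟩ := h.isBounded.closure.exists_norm_le
  set M := max R 0 with hM
  have hM0 : 0 ≤ M := le_max_right _ _
  have hre : ∀ z ∈ closure Ω, ‖(z.re : ℂ)‖ ≤ M := fun z hz => by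
    rw [Complex.norm_real]
    exact (Complex.abs_re_le_norm z).trans ((hR z hz).trans (le_max_left _ _))
  refine ⟨2 * M, by positivity, fun p hp => ?_⟩
  refine traceGraph_induction (h := h)
    (P := fun p => ‖p.1‖ ^ 2 ≤ 2 * M * (‖p.1‖ * ‖p.2.1‖ + ‖p.2.2.2‖ ^ 2))
    (isClosed_le (by fun_prop) (by fun_prop)) (fun φ hφ => ?_) hp
  have hx : ContDiff ℝ ∞ fun z : ℂ => (z.re : ℂ) :=
    Complex.ofRealCLM.contDiff.comp Complex.reCLM.contDiff
  -- Pairing φ with xφ puts ‖φ‖² into the integration by parts, since ∂ₓ(xφ) = φ + x∂ₓφ; every other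
  -- term carries the factor |x| ≤ M.
  have hψ : ContDiff ℝ ∞ fun z : ℂ => (z.re : ℂ) * φ z := hx.mul hφ
  have hdψ : ∀ z, fderiv ℝ (fun z : ℂ => (z.re : ℂ) * φ z) z 1 =
      φ z + (z.re : ℂ) * fderiv ℝ φ z 1 := by
    intro z
    have hxd : HasFDerivAt (fun z : ℂ => (z.re : ℂ)) (Complex.ofRealCLM.comp Complex.reCLM) z :=
      (Complex.ofRealCLM.comp Complex.reCLM).hasFDerivAt
    rw [fderiv_fun_mul hxd.differentiableAt (hφ.differentiable (by simp) z), hxd.fderiv]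
    simp; ring
  have key := norm_inner_toLp_add_le h hφ hψ isFrame_one_I
  set a := (h.memLp hφ.continuous).toLp φ with ha
  set b := (h.memLp (continuous_fderiv_apply hφ 1)).toLp _ with hb
  set g := (h.memLp_bdry hφ.continuous).toLp φ with hg
  set xa := (h.memLp hψ.continuous).toLp _ with hxa
  set xg := (h.memLp_bdry hψ.continuous).toLp _ with hxg
  have hxb' : Continuous fun z : ℂ => (z.re : ℂ) * fderiv ℝ φ z 1 :=
    hx.continuous.mul (continuous_fderiv_apply hφ 1)
  set xb := (h.memLp hxb').toLp _ with hxb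
  have hsum : (h.memLp (continuous_fderiv_apply hψ 1)).toLp _ = a + xb := by
    rw [ha, hxb, ← MemLp.toLp_add]
    congr 1
    funext z
    exact hdψ z
  rw [hsum, inner_add_left] at key
  have hmono : ∀ {μ : Measure ℂ} {f : ℂ → ℂ} (hf : MemLp f 2 μ)
      (hxf : MemLp (fun z : ℂ => (z.re : ℂ) * f z) 2 μ), (∀ᵐ z ∂μ, z ∈ closure Ω) →
      ‖hxf.toLp _‖ ≤ M * ‖hf.toLp f‖ := by
    intro μ f hf hxf hae
    refine Lp.norm_le_mul_norm_of_ae_le_mul ?_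
    filter_upwards [hf.coeFn_toLp, hxf.coeFn_toLp, hae] with z h1 h2 h3
    rw [h1, h2, norm_mul]
    exact mul_le_mul_of_nonneg_right (hre z h3) (norm_nonneg _)
  have haeΩ : ∀ᵐ z ∂(volume.restrict Ω), z ∈ closure Ω :=
    (ae_restrict_mem h.isOpen.measurableSet).mono fun z hz => subset_closure hz
  have haeb : ∀ᵐ z ∂(bdryMeasure Ω), z ∈ closure Ω :=
    (ae_restrict_mem isClosed_frontier.measurableSet).mono fun z hz => frontier_subset_closure hz
  have h1 : ‖xa‖ ≤ M * ‖a‖ := hmono _ _ haeΩ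
  have h2 : ‖xb‖ ≤ M * ‖b‖ := hmono _ _ haeΩ
  have h3 : ‖xg‖ ≤ M * ‖g‖ := hmono _ _ haeb
  have h4 : ‖a‖ ^ 2 = ‖inner ℂ a a‖ := by
    rw [inner_self_eq_norm_sq_to_K]; simp
  have h5 : ‖inner ℂ a a‖ ≤ ‖inner ℂ xa b + (inner ℂ a a + inner ℂ xb a)‖ +
      (‖xa‖ * ‖b‖ + ‖xb‖ * ‖a‖) := by
    calc ‖inner ℂ a a‖ = ‖(inner ℂ xa b + (inner ℂ a a + inner ℂ xb a)) -
          (inner ℂ xa b + inner ℂ xb a)‖ := by congr 1; ring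
      _ ≤ _ := (norm_sub_le _ _).trans (add_le_add_right ((norm_add_le _ _).trans
          (add_le_add (norm_inner_le_norm _ _) (norm_inner_le_norm _ _))) _)
  change ‖a‖ ^ 2 ≤ 2 * M * (‖a‖ * ‖b‖ + ‖g‖ ^ 2)
  have h6 := mul_le_mul_of_nonneg_right h1 (norm_nonneg b)
  have h7 := mul_le_mul_of_nonneg_right h2 (norm_nonneg a)
  have h8 := mul_le_mul_of_nonneg_left h3 (norm_nonneg g)
  nlinarith

/-! ### Fatou's lemma, Sobolev embedding and Rellich compactness. -/

/-- Fatou's lemma along convergent sequences in `L²`. -/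
theorem lintegral_le_of_tendsto {α : Type*} [MeasurableSpace α] {μ : Measure α}
    {f g : ℕ → Lp ℂ 2 μ} {f' g' : Lp ℂ 2 μ} (hf : Tendsto f atTop (𝓝 f'))
    (hg : Tendsto g atTop (𝓝 g')) {Φ : ℂ × ℂ → ℝ≥0∞} (hΦ : Continuous Φ) {c : ℝ≥0∞}
    (hc : ∀ᶠ n in atTop, ∫⁻ z, Φ (f n z, g n z) ∂μ ≤ c) : ∫⁻ z, Φ (f' z, g' z) ∂μ ≤ c := by
  obtain ⟨k, hk, hfk⟩ := (tendstoInMeasure_of_tendsto_Lp hf).exists_seq_tendsto_ae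
  obtain ⟨l, hl, hgl⟩ := (tendstoInMeasure_of_tendsto_Lp
    (hg.comp hk.tendsto_atTop)).exists_seq_tendsto_ae
  have hae : ∀ᵐ z ∂μ, Φ (f' z, g' z) =
      liminf (fun n => Φ (f (k (l n)) z, g (k (l n)) z)) atTop := by
    filter_upwards [hfk, hgl] with z h1 h2
    exact ((hΦ.tendsto _).comp ((h1.comp hl.tendsto_atTop).prodMk_nhds h2)).liminf_eq.symm
  rw [lintegral_congr_ae hae]
  refine (lintegral_liminf_le' fun n => ?_).trans ?_
  · exact hΦ.measurable.comp_aemeasurable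
      ((Lp.aestronglyMeasurable _).aemeasurable.prodMk (Lp.aestronglyMeasurable _).aemeasurable)
  · have hev : ∀ᶠ n in atTop, ∫⁻ z, Φ (f (k (l n)) z, g (k (l n)) z) ∂μ ≤ c :=
      (hk.comp hl).tendsto_atTop.eventually hc
    refine (liminf_le_liminf hev).trans ?_
    exact (liminf_const c).le

/-- Apply the Gagliardo–Nirenberg inequality to φ². Cauchy–Schwarz bounds the L¹ norms of its
derivatives 2φ∂φ by 2m² and that of its boundary values by m², so each factor is at most 4m². -/
theorem lintegral_toGraph_pow_four_le {Ω : Set ℂ} (h : HasRectifiableBoundary Ω) {φ : ℂ → ℂ}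
    (hφ : ContDiff ℝ ∞ φ) {m : ℝ≥0∞} (hm : ‖toGraph h hφ‖ₑ ≤ m) :
    ∫⁻ z in Ω, ‖φ z‖ₑ ^ 4 ≤ (4 * m ^ 2) ^ 2 := by
  have hF : ContDiff ℝ ∞ fun z => φ z * φ z := hφ.mul hφ
  have h1 : ‖(toGraph h hφ).1‖ₑ ≤ m := by
    refine le_trans ?_ hm
    exact (by simpa [enorm_le_iff_norm_le] using norm_fst_le (toGraph h hφ))
  have h2' : ‖(toGraph h hφ).2‖ₑ ≤ m := by
    refine le_trans ?_ hm
    exact (by simpa [enorm_le_iff_norm_le] using norm_snd_le (toGraph h hφ))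
  have h2 : ‖(toGraph h hφ).2.1‖ₑ ≤ m := by
    refine le_trans ?_ h2'
    exact (by simpa [enorm_le_iff_norm_le] using norm_fst_le (toGraph h hφ).2)
  have h3' : ‖(toGraph h hφ).2.2‖ₑ ≤ m := by
    refine le_trans ?_ h2'
    exact (by simpa [enorm_le_iff_norm_le] using norm_snd_le (toGraph h hφ).2)
  have h3 : ‖(toGraph h hφ).2.2.1‖ₑ ≤ m := by
    refine le_trans ?_ h3'
    exact (by simpa [enorm_le_iff_norm_le] using norm_fst_le (toGraph h hφ).2.2)
  have h4 : ‖(toGraph h hφ).2.2.2‖ₑ ≤ m := by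
    refine le_trans ?_ h3'
    exact (by simpa [enorm_le_iff_norm_le] using norm_snd_le (toGraph h hφ).2.2)
  have hder : ∀ v, ∫⁻ z in Ω, ‖fderiv ℝ (fun z => φ z * φ z) z v‖ₑ ≤
      2 * (‖(toGraph h hφ).1‖ₑ * ‖(h.memLp (continuous_fderiv_apply hφ v)).toLp _‖ₑ) := by
    intro v
    have hd := hφ.differentiable (by simp)
    have : ∀ z, ‖fderiv ℝ (fun z => φ z * φ z) z v‖ₑ = 2 * (‖φ z‖ₑ * ‖fderiv ℝ φ z v‖ₑ) := by
      intro z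
      rw [fderiv_fun_mul (hd z) (hd z)]
      simp only [add_apply, smul_apply, smul_eq_mul]
      rw [← two_mul, enorm_mul, enorm_mul]
      congr 1
      rw [← ofReal_norm]; simp
    simp only [this]
    rw [lintegral_const_mul' _ _ ENNReal.ofNat_ne_top]
    exact mul_le_mul_right (lintegral_toLp_mul_le (h.memLp hφ.continuous)
      (h.memLp (continuous_fderiv_apply hφ v))) 2
  have hb : ∫⁻ z in frontier Ω, ‖φ z * φ z‖ₑ ∂(μH[1] : Measure ℂ) ≤ m ^ 2 := by
    rw [← bdryMeasure]
    simp only [enorm_mul]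
    refine (lintegral_toLp_mul_le (h.memLp_bdry hφ.continuous)
      (h.memLp_bdry hφ.continuous)).trans ?_
    rw [sq]
    exact mul_le_mul' h4 h4
  have key := lintegral_enorm_sq_le h.isOpen h.isBounded h.finite
    (hF.of_le (by simp) : ContDiff ℝ 1 _)
  calc ∫⁻ z in Ω, ‖φ z‖ₑ ^ 4 = ∫⁻ z in Ω, ‖φ z * φ z‖ₑ ^ 2 := by
        refine lintegral_congr fun z => ?_
        rw [enorm_mul]; ring
    _ ≤ _ := key
    _ ≤ (2 * (m * m) + 2 * m ^ 2) * (2 * (m * m) + 2 * m ^ 2) := by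
        refine mul_le_mul' (add_le_add ((hder 1).trans ?_) (mul_le_mul_right hb 2))
          (add_le_add ((hder Complex.I).trans ?_) (mul_le_mul_right hb 2))
        · exact mul_le_mul_right (mul_le_mul' h1 h2) 2
        · exact mul_le_mul_right (mul_le_mul' h1 h3) 2
    _ = _ := by ring

/-- The Sobolev embedding `H¹ ⊆ L⁴`. -/
theorem lintegral_pow_four_le {Ω : Set ℂ} {h : HasRectifiableBoundary Ω} {p : GraphSpace Ω}
    (hp : p ∈ traceGraph h) {M : ℝ} (hM : ‖p‖ < M) :
    ∫⁻ z in Ω, ‖p.1 z‖ₑ ^ 4 ≤ (4 * ENNReal.ofReal M ^ 2) ^ 2 := by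
  obtain ⟨s, hs, hsp⟩ := mem_closure_iff_seq_limit.1 hp
  have hs1 : Tendsto (fun n => (s n).1) atTop (𝓝 p.1) := (continuous_fst.tendsto p).comp hsp
  refine lintegral_le_of_tendsto hs1 hs1 (Φ := fun w => ‖w.1‖ₑ ^ 4) (by fun_prop) ?_
  filter_upwards [hsp.norm.eventually (gt_mem_nhds hM)] with n hn
  obtain ⟨φ, hφ, hφs⟩ := mem_smoothGraph.1 (hs n)
  rw [← hφs] at hn ⊢
  have := lintegral_toGraph_pow_four_le h hφ (m := ENNReal.ofReal M)
    (by rw [← ofReal_norm]; exact ENNReal.ofReal_le_ofReal hn.le)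
  refine le_trans (le_of_eq (lintegral_congr_ae ?_)) this
  filter_upwards [(h.memLp hφ.continuous).coeFn_toLp] with z hz
  simp only [toGraph, hz]

/-- Rellich's compactness theorem. -/
theorem totallyBounded_traceGraph {Ω : Set ℂ} (h : HasRectifiableBoundary Ω) (M : ℝ) :
    TotallyBounded {a | ∃ p ∈ traceGraph h, ‖p‖ ≤ M ∧ p.1 = a} := by
  rw [Metric.totallyBounded_iff]
  intro ε hε
  set m : NNReal := Real.toNNReal (M + 1) with hm
  -- One constant for both the gradient bound m² and the L⁴ bound (4m²)². The 1 in m leaves room to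
  -- replace p by a nearby smooth graph.
  set C : NNReal := m ^ 2 + (4 * m ^ 2) ^ 2 with hC
  set e : NNReal := ⟨ε / 8, by positivity⟩ with he
  have he0 : 0 < e ^ 2 := pow_pos (show (0 : ℝ) < ε / 8 by positivity) 2
  obtain ⟨E, hE, hEF⟩ := exists_finiteDimensional_approx h.isOpen h.isBounded C he0
  have : ProperSpace E := FiniteDimensional.proper ℂ E
  -- Approximants stay within ε of the M-ball, and a ball of a finite dimensional space is compact;
  -- its finite ε/2-net serves the original set, as the approximation error is at most ε/4.
  have hcpt : IsCompact ((fun x : E => (x : Lp ℂ 2 (volume.restrict Ω))) ''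
      Metric.closedBall 0 (M + ε)) :=
    (isCompact_closedBall _ _).image continuous_subtype_val
  obtain ⟨t, htf, ht⟩ := Metric.totallyBounded_iff.1 hcpt.totallyBounded (ε / 2) (by positivity)
  refine ⟨t, htf, ?_⟩
  rintro _ ⟨p, hp, hpM, rfl⟩
  obtain ⟨q, hq, hpq⟩ := Metric.mem_closure_iff.1 hp (min 1 (ε / 8)) (by positivity)
  obtain ⟨φ, hφ, rfl⟩ := mem_smoothGraph.1 hq
  have hqM : ‖toGraph h hφ‖ ≤ M + 1 := by
    have h1 : dist p (toGraph h hφ) < 1 := hpq.trans_le (min_le_left _ _)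
    rw [dist_eq_norm'] at h1
    calc ‖toGraph h hφ‖ = ‖p + (toGraph h hφ - p)‖ := by congr 1; abel
      _ ≤ _ := (norm_add_le _ _).trans (by linarith)
  have hqm : ‖toGraph h hφ‖ₑ ≤ m := by
    rw [← ofReal_norm]; exact ENNReal.ofReal_le_ofReal hqM
  have hmono : ∀ {a : Lp ℂ 2 (volume.restrict Ω)}, ‖a‖ ≤ ‖toGraph h hφ‖ →
      ‖a‖ₑ ^ 2 ≤ (C : ℝ≥0∞) := by
    intro a ha
    have : ‖a‖ₑ ≤ m := by
      rw [← ofReal_norm]; exact ENNReal.ofReal_le_ofReal (ha.trans hqM)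
    refine (pow_le_pow_left' this 2).trans ?_
    rw [hC]; push_cast; exact le_self_add
  obtain ⟨f, hfE, hf⟩ := hEF φ (hφ.of_le (by simp))
    (by
      rw [lintegral_toLp_sq (h.memLp (continuous_fderiv_apply hφ 1))]
      exact hmono ((norm_fst_le (toGraph h hφ).2).trans (norm_snd_le _)))
    (by
      rw [lintegral_toLp_sq (h.memLp (continuous_fderiv_apply hφ Complex.I))]
      exact hmono ((norm_fst_le (toGraph h hφ).2.2).trans
        ((norm_snd_le (toGraph h hφ).2).trans (norm_snd_le _))))
    (by
      refine (lintegral_toGraph_pow_four_le h hφ hqm).trans ?_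
      rw [hC]; push_cast; exact le_add_self)
  have hfq : ‖(toGraph h hφ).1 - f‖ ≤ ε / 8 := by
    have h1 : ‖(toGraph h hφ).1 - f‖ₑ ^ 2 ≤ (e : ℝ≥0∞) ^ 2 := by
      rw [enorm_Lp_sq]
      refine le_trans (le_of_eq (lintegral_congr_ae ?_)) (hf.trans (by push_cast; rfl))
      filter_upwards [(h.memLp hφ.continuous).coeFn_toLp,
        Lp.coeFn_sub (toGraph h hφ).1 f] with z hz1 hz2
      rw [hz2, Pi.sub_apply]
      simp only [toGraph, hz1]
    have h2 := (ENNReal.pow_right_strictMono (n := 2) two_ne_zero).le_iff_le.1 h1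
    rw [enorm_eq_nnnorm, ENNReal.coe_le_coe] at h2
    exact h2
  have hpf : ‖p.1 - f‖ ≤ ε / 4 := by
    have h1 : ‖p.1 - (toGraph h hφ).1‖ ≤ ε / 8 := by
      have : dist p (toGraph h hφ) < ε / 8 := hpq.trans_le (min_le_right _ _)
      rw [dist_eq_norm] at this
      exact (norm_fst_le (p - toGraph h hφ)).trans this.le
    calc ‖p.1 - f‖ = ‖(p.1 - (toGraph h hφ).1) + ((toGraph h hφ).1 - f)‖ := by congr 1; abel
      _ ≤ _ := (norm_add_le _ _).trans (by linarith)
  have hfmem : f ∈ (fun x : E => (x : Lp ℂ 2 (volume.restrict Ω))) ''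
      Metric.closedBall 0 (M + ε) := by
    refine ⟨⟨f, hfE⟩, ?_, rfl⟩
    rw [mem_closedBall_zero_iff]
    change ‖f‖ ≤ M + ε
    have h1 : ‖p.1‖ ≤ M := (norm_fst_le p).trans hpM
    calc ‖f‖ = ‖p.1 - (p.1 - f)‖ := by congr 1; abel
      _ ≤ _ := (norm_sub_le _ _).trans (by linarith)
  obtain ⟨y, hy, hfy⟩ := Set.mem_iUnion₂.1 (ht hfmem)
  refine Set.mem_iUnion₂.2 ⟨y, hy, ?_⟩
  rw [Metric.mem_ball] at hfy ⊢
  have := dist_triangle p.1 f y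
  rw [dist_eq_norm p.1 f] at this
  linarith

theorem exists_subseq_tendsto {Ω : Set ℂ} (h : HasRectifiableBoundary Ω) (M : ℝ)
    {s : ℕ → GraphSpace Ω} (hs : ∀ n, s n ∈ traceGraph h) (hM : ∀ n, ‖s n‖ ≤ M) :
    ∃ (u : Lp ℂ 2 (volume.restrict Ω)) (φ : ℕ → ℕ), StrictMono φ ∧
      Tendsto (fun n => (s (φ n)).1) atTop (𝓝 u) := by
  have hcpt := (totallyBounded_traceGraph h M).closure.isCompact_of_isClosed isClosed_closure
  obtain ⟨u, -, φ, hφ, hu⟩ := hcpt.tendsto_subseq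
    (fun n => subset_closure ⟨s n, hs n, hM n, rfl⟩)
  exact ⟨u, φ, hφ, hu⟩

/-! ### Sobolev functions with a trace as points of the trace graph. -/

/-- The element of the graph space defined by a Sobolev function and a boundary datum. -/
def H1.toGraphSpace {Ω : Set ℂ} (u : H1 Ω) {g : ℂ → ℂ} (hg : MemLp g 2 (bdryMeasure Ω)) :
    GraphSpace Ω :=
  (u.memLp_toFun.toLp _, u.memLp_dx.toLp _, u.memLp_dy.toLp _, hg.toLp g)

/-- In a metric space closure is sequential, and convergence in the product is convergence of the
four components, which is how traces are defined. -/
theorem hasTrace_iff_mem {Ω : Set ℂ} (h : HasRectifiableBoundary Ω) (u : H1 Ω) {g : ℂ → ℂ}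
    (hg : MemLp g 2 (bdryMeasure Ω)) :
    HasTrace u g ↔ u.toGraphSpace hg ∈ traceGraph h := by
  have key : ∀ (φ : ℕ → ℂ → ℂ) (hφ : ∀ k, ContDiff ℝ ∞ (φ k)),
      Tendsto (fun k => toGraph h (hφ k)) atTop (𝓝 (u.toGraphSpace hg)) ↔
      Tendsto (fun k => eLpNorm (fun z => φ k z - u.toFun z) 2 (volume.restrict Ω)) atTop (𝓝 0) ∧
      Tendsto (fun k => eLpNorm (fun z => fderiv ℝ (φ k) z 1 - u.dx z) 2 (volume.restrict Ω))
        atTop (𝓝 0) ∧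
      Tendsto (fun k => eLpNorm (fun z => fderiv ℝ (φ k) z Complex.I - u.dy z) 2
        (volume.restrict Ω)) atTop (𝓝 0) ∧
      Tendsto (fun k => eLpNorm (fun z => φ k z - g z) 2 (bdryMeasure Ω)) atTop (𝓝 0) := by
    intro φ hφ
    rw [H1.toGraphSpace, Prod.tendsto_iff, Prod.tendsto_iff, Prod.tendsto_iff]
    have hc := fun k => (hφ k).continuous
    exact and_congr (Lp.tendsto_Lp_iff_tendsto_eLpNorm'' _ (fun k => h.memLp (hc k)) _
        u.memLp_toFun)
      (and_congr (Lp.tendsto_Lp_iff_tendsto_eLpNorm'' _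
        (fun k => h.memLp (continuous_fderiv_apply (hφ k) 1)) _ u.memLp_dx)
      (and_congr (Lp.tendsto_Lp_iff_tendsto_eLpNorm'' _
        (fun k => h.memLp (continuous_fderiv_apply (hφ k) Complex.I)) _ u.memLp_dy)
      (Lp.tendsto_Lp_iff_tendsto_eLpNorm'' _ (fun k => h.memLp_bdry (hc k)) _ hg)))
  constructor
  · rintro ⟨φ, hφ, hlim⟩
    exact mem_closure_iff_seq_limit.2
      ⟨_, fun k => mem_smoothGraph.2 ⟨φ k, hφ k, rfl⟩, (key φ hφ).2 hlim⟩
  · intro hmem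
    obtain ⟨s, hs, hlim⟩ := mem_closure_iff_seq_limit.1 hmem
    choose φ hφ hφs using fun n => mem_smoothGraph.1 (hs n)
    have : s = fun k => toGraph h (hφ k) := funext fun k => (hφs k).symm
    rw [this] at hlim
    exact ⟨φ, hφ, (key φ hφ).1 hlim⟩

/-- Elements of the trace graph satisfy the defining relation of weak derivatives. -/
theorem isWeakDeriv_of_mem {Ω : Set ℂ} {h : HasRectifiableBoundary Ω} {p : GraphSpace Ω}
    (hp : p ∈ traceGraph h) :
    IsWeakDeriv Ω 1 p.1 p.2.1 ∧ IsWeakDeriv Ω Complex.I p.1 p.2.2.1 := by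
  -- The inner product conjugates its first slot, so one tests with the conjugate of φ; its support
  -- in the open set Ω misses the frontier, which removes the boundary term.
  have hbd : ∀ φ : ℂ → ℂ, (hφ : ContDiff ℝ ∞ φ) → tsupport φ ⊆ Ω →
      (toGraph h (contDiff_conj_comp hφ)).2.2.2 = 0 := by
    intro φ hφ hsupp
    refine Lp.ext ?_
    filter_upwards [(h.memLp_bdry (contDiff_conj_comp hφ).continuous).coeFn_toLp,
      Lp.coeFn_zero ℂ 2 (bdryMeasure Ω), ae_restrict_mem isClosed_frontier.measurableSet]
      with z h1 h2 h3
    rw [h2]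
    refine h1.trans ?_
    have hz : z ∉ tsupport φ := fun hz => by
      rw [h.isOpen.frontier_eq] at h3
      exact h3.2 (hsupp hz)
    simp [image_eq_zero_of_notMem_tsupport hz]
  have hint : ∀ (a : Lp ℂ 2 (volume.restrict Ω)) (f : ℂ → ℂ) (hf : Continuous fun z => conj (f z)),
      inner ℂ ((h.memLp hf).toLp _) a = ∫ z in Ω, a z * f z := by
    intro a f hf
    rw [L2.inner_def]
    refine integral_congr_ae ?_
    filter_upwards [(h.memLp hf).coeFn_toLp] with z hz
    rw [hz, RCLike.inner_apply]
    simp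
  have hfd : ∀ φ : ℂ → ℂ, (hφ : ContDiff ℝ ∞ φ) → ∀ v,
      (h.memLp (continuous_fderiv_apply (contDiff_conj_comp hφ) v)).toLp _ =
      (h.memLp (show Continuous fun z => conj (fderiv ℝ φ z v) from
        Complex.continuous_conj.comp (continuous_fderiv_apply hφ v))).toLp
        (fun z => conj (fderiv ℝ φ z v)) := by
    intro φ hφ v
    congr 1
    funext z
    exact fderiv_conj_comp (hφ.differentiable (by simp) z) v
  constructor
  · intro φ hφ _ hsupp
    have h1 := norm_inner_add_dx_le hp (toGraph_mem h (contDiff_conj_comp hφ))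
    rw [hbd φ hφ hsupp, norm_zero, mul_zero, mul_zero, norm_le_zero_iff] at h1
    simp only [toGraph] at h1
    rw [hfd φ hφ 1, hint _ φ (contDiff_conj_comp hφ).continuous, hint _ (fun z => fderiv ℝ φ z 1)
      (Complex.continuous_conj.comp (continuous_fderiv_apply hφ 1))] at h1
    exact eq_neg_of_add_eq_zero_right h1
  · intro φ hφ _ hsupp
    have h1 := norm_inner_add_dy_le hp (toGraph_mem h (contDiff_conj_comp hφ))
    rw [hbd φ hφ hsupp, norm_zero, mul_zero, mul_zero, norm_le_zero_iff] at h1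
    simp only [toGraph] at h1
    rw [hfd φ hφ Complex.I, hint _ φ (contDiff_conj_comp hφ).continuous, hint _ (fun z => fderiv ℝ φ z Complex.I)
      (Complex.continuous_conj.comp (continuous_fderiv_apply hφ Complex.I))] at h1
    exact eq_neg_of_add_eq_zero_right h1

/-! ### Algebra of the kinetic form. -/

section KineticForm

variable {H : Type*} [NormedAddCommGroup H] [InnerProductSpace ℂ H]

/-- The kinetic energy as a quadratic form of `(∂ₓη₊, ∂_yη₊, ∂ₓη₋, ∂_yη₋)`. -/
def kinForm (ν : ℝ) (a b c d : H) : ℝ :=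
  (inner ℂ a a).re + (inner ℂ b b).re + ((inner ℂ c c).re + (inner ℂ d d).re)
    + (1 + ν) * ((inner ℂ a c).re - (inner ℂ b d).re)
    + (1 - ν) * ((inner ℂ c b).im - (inner ℂ a d).im)

theorem kinForm_parallelogram (ν : ℝ) (a b c d a' b' c' d' : H) :
    kinForm ν (a + a') (b + b') (c + c') (d + d') + kinForm ν (a - a') (b - b') (c - c') (d - d')
      = 2 * kinForm ν a b c d + 2 * kinForm ν a' b' c' d' := by
  simp only [kinForm, inner_add_left, inner_add_right, inner_sub_left, inner_sub_right,
    Complex.add_re, Complex.sub_re, Complex.add_im, Complex.sub_im]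
  ring

theorem norm_sq_eq_inner_re (a : H) : ‖a‖ ^ 2 = (inner ℂ a a).re :=
  norm_sq_eq_re_inner (𝕜 := ℂ) a

theorem inner_re_comm (a b : H) : (inner ℂ a b).re = (inner ℂ b a).re := by
  rw [← inner_conj_symm, Complex.conj_re]

theorem inner_im_comm (a b : H) : (inner ℂ a b).im = -(inner ℂ b a).im := by
  rw [← inner_conj_symm, Complex.conj_im]

/-- Here a + ib is 2∂̄η₊, c - id is 2∂η₋, a - ib is 2∂η₊ and c + id is 2∂̄η₋. In these variables ν
couples only ∂̄η₊ and ∂η₋. -/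
theorem kinForm_eq (ν : ℝ) (a b c d : H) :
    kinForm ν a b c d = 1 / 2 * ‖a - Complex.I • b + c + Complex.I • d‖ ^ 2
      + 1 / 2 * ‖a + Complex.I • b‖ ^ 2 + 1 / 2 * ‖c - Complex.I • d‖ ^ 2
      + ν * (inner ℂ (a + Complex.I • b) (c - Complex.I • d)).re := by
  simp only [norm_sq_eq_inner_re, kinForm, inner_add_left, inner_add_right, inner_sub_left,
    inner_sub_right, inner_smul_left, inner_smul_right]
  simp only [Complex.conj_I, Complex.add_re, Complex.sub_re, Complex.mul_re, Complex.mul_im,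
    Complex.neg_re, Complex.neg_im, Complex.I_re, Complex.I_im, Complex.add_im, Complex.sub_im]
  rw [inner_re_comm c a, inner_re_comm d b, inner_im_comm b a, inner_im_comm d a,
    inner_im_comm c b, inner_im_comm d c]
  ring

/-- Drop the first square and absorb the coupling by |ν|‖B‖‖D‖ ≤ |ν|(‖B‖² + ‖D‖²)/2. -/
theorem le_kinForm {ν : ℝ} (a b c d : H) :
    (1 - |ν|) / 2 * (‖a + Complex.I • b‖ ^ 2 + ‖c - Complex.I • d‖ ^ 2) ≤ kinForm ν a b c d := by
  rw [kinForm_eq]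
  set B := a + Complex.I • b
  set D := c - Complex.I • d
  have h1 : |(inner ℂ B D).re| ≤ ‖B‖ * ‖D‖ :=
    (Complex.abs_re_le_norm _).trans (norm_inner_le_norm B D)
  have h2 : |ν * (inner ℂ B D).re| ≤ |ν| * (‖B‖ * ‖D‖) := by
    rw [abs_mul]; exact mul_le_mul_of_nonneg_left h1 (abs_nonneg ν)
  have h3 := neg_abs_le (ν * (inner ℂ B D).re)
  have h4 := mul_nonneg (abs_nonneg ν) (sq_nonneg (‖B‖ - ‖D‖))
  have h5 := sq_nonneg ‖a - Complex.I • b + c + Complex.I • d‖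
  nlinarith

/-- The cross term is -2 Im⟨a, b⟩, which for a = ∂ₓu and b = ∂_yu is the integrated Jacobian up to a
factor. -/
theorem norm_add_I_smul_sq (a b : H) (h : (inner ℂ a b).im = 0) :
    ‖a + Complex.I • b‖ ^ 2 = ‖a‖ ^ 2 + ‖b‖ ^ 2 := by
  simp only [norm_sq_eq_inner_re, inner_add_left, inner_add_right, inner_smul_left,
    inner_smul_right]
  simp only [Complex.conj_I, Complex.add_re, Complex.mul_re, Complex.mul_im, Complex.neg_re,
    Complex.neg_im, Complex.I_re, Complex.I_im, Complex.add_im]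
  rw [inner_im_comm b a, h]
  ring

theorem norm_sub_I_smul_sq (a b : H) (h : (inner ℂ a b).im = 0) :
    ‖a - Complex.I • b‖ ^ 2 = ‖a‖ ^ 2 + ‖b‖ ^ 2 := by
  have := norm_add_I_smul_sq a (-b) (by rw [inner_neg_right, Complex.neg_im, h, neg_zero])
  rwa [smul_neg, ← sub_eq_add_neg, norm_neg] at this

end KineticForm

/-! ### Bounds on the potential. -/

/-- The potential energy density as a function of the values of `η`. -/
def pot (ν : ℝ) (w : ℂ × ℂ) : ℝ :=
  1 / 2 * (‖w.1‖ ^ 2 - 1) ^ 2 + 1 / 2 * (‖w.2‖ ^ 2 - 1) ^ 2 + 2 * ‖w.1‖ ^ 2 * ‖w.2‖ ^ 2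
    + ν * dot (w.1 ^ 2) (w.2 ^ 2)

theorem continuous_pot (ν : ℝ) : Continuous (pot ν) := by
  unfold pot dot
  fun_prop

theorem abs_dot_le (a b : ℂ) : |dot a b| ≤ ‖a‖ * ‖b‖ := by
  have h : dot a b = (b * conj a).re := by simp [dot]; ring
  rw [h]
  refine (Complex.abs_re_le_norm _).trans ?_
  rw [norm_mul, RCLike.norm_conj, mul_comm]

theorem abs_mul_dot_sq_le {ν : ℝ} (hν : ν ∈ Set.Ioo (-1 : ℝ) 1) (w : ℂ × ℂ) :
    |ν * dot (w.1 ^ 2) (w.2 ^ 2)| ≤ ‖w.1‖ ^ 2 * ‖w.2‖ ^ 2 := by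
  have h1 := abs_dot_le (w.1 ^ 2) (w.2 ^ 2)
  rw [norm_pow, norm_pow] at h1
  have h2 : |ν| ≤ 1 := (abs_lt.2 hν).le
  rw [abs_mul]
  calc |ν| * |dot (w.1 ^ 2) (w.2 ^ 2)| ≤ 1 * |dot (w.1 ^ 2) (w.2 ^ 2)| := by gcongr
    _ ≤ _ := by rw [one_mul]; exact h1

/-- Since |ν| < 1, the term 2|η₊|²|η₋|² dominates the coupling, the only term without a sign. -/
theorem pot_nonneg {ν : ℝ} (hν : ν ∈ Set.Ioo (-1 : ℝ) 1) (w : ℂ × ℂ) : 0 ≤ pot ν w := by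
  have h1 := (abs_le.1 (abs_mul_dot_sq_le hν w)).1
  have h2 : 0 ≤ ‖w.1‖ ^ 2 * ‖w.2‖ ^ 2 := by positivity
  unfold pot
  nlinarith [sq_nonneg (‖w.1‖ ^ 2 - 1), sq_nonneg (‖w.2‖ ^ 2 - 1)]

theorem pot_le {ν : ℝ} (hν : ν ∈ Set.Ioo (-1 : ℝ) 1) (w : ℂ × ℂ) :
    pot ν w ≤ 2 + 3 * ‖w.1‖ ^ 4 + 3 * ‖w.2‖ ^ 4 := by
  have h1 := (abs_le.1 (abs_mul_dot_sq_le hν w)).2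
  unfold pot
  nlinarith [sq_nonneg (‖w.1‖ ^ 2 - ‖w.2‖ ^ 2), sq_nonneg (‖w.1‖ ^ 2 + 1),
    sq_nonneg (‖w.2‖ ^ 2 + 1)]

/-! ### Coercivity and minimization in the graph space. -/

/-- The pairs of elements of the trace graph with given boundary values. -/
def admissible {Ω : Set ℂ} (h : HasRectifiableBoundary Ω) (G G' : Lp ℂ 2 (bdryMeasure Ω)) :
    Set (GraphSpace Ω × GraphSpace Ω) :=
  {x | (x.1 ∈ traceGraph h ∧ x.1.2.2.2 = G) ∧ (x.2 ∈ traceGraph h ∧ x.2.2.2.2 = G')}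

/-- The kinetic energy on the graph space. -/
def kinEnergy {Ω : Set ℂ} (ν : ℝ) (x : GraphSpace Ω × GraphSpace Ω) : ℝ :=
  kinForm ν x.1.2.1 x.1.2.2.1 x.2.2.1 x.2.2.2.1

/-- The potential energy on pairs of square integrable functions. -/
def potEnergy {Ω : Set ℂ} (ν κ : ℝ)
    (y : Lp ℂ 2 (volume.restrict Ω) × Lp ℂ 2 (volume.restrict Ω)) : ℝ :=
  (∫⁻ z in Ω, ENNReal.ofReal (κ ^ 2 * pot ν (y.1 z, y.2 z))).toReal

/-- Without boundary term, Poincaré's inequality reads ‖p‖² ≤ C‖p‖‖∂ₓp‖ in L², and one factor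
cancels. The graph space carries the maximum norm of its four components. -/
theorem norm_sq_le_of_trace_zero {Ω : Set ℂ} (h : HasRectifiableBoundary Ω) :
    ∃ C : ℝ, 0 ≤ C ∧ ∀ p ∈ traceGraph h, p.2.2.2 = 0 →
      ‖p‖ ^ 2 ≤ C * (‖p.2.1‖ ^ 2 + ‖p.2.2.1‖ ^ 2) := by
  obtain ⟨C, hC, hCp⟩ := exists_norm_sq_le h
  refine ⟨1 + C ^ 2, by positivity, fun p hp hp0 => ?_⟩
  have h1 := hCp p hp
  rw [hp0, norm_zero, zero_pow two_ne_zero, add_zero] at h1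
  have h2 : ‖p.1‖ ≤ C * ‖p.2.1‖ := by
    rcases (norm_nonneg p.1).eq_or_lt with h0 | h0
    · rw [← h0]; positivity
    · nlinarith
  have h3 : ‖p.1‖ ^ 2 ≤ C ^ 2 * ‖p.2.1‖ ^ 2 := by
    rw [← mul_pow]; exact pow_le_pow_left₀ (norm_nonneg _) h2 2
  have hb := sq_nonneg ‖p.2.1‖
  have hc := sq_nonneg ‖p.2.2.1‖
  have hb' := mul_nonneg (sq_nonneg C) hb
  have hc' := mul_nonneg (sq_nonneg C) hc
  have hmax : ‖p‖ = max ‖p.1‖ (max ‖p.2.1‖ (max ‖p.2.2.1‖ ‖p.2.2.2‖)) := rfl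
  rw [hmax, hp0, norm_zero, max_eq_left (norm_nonneg p.2.2.1)]
  rcases max_choice ‖p.1‖ (max ‖p.2.1‖ ‖p.2.2.1‖) with h4 | h4
  · rw [h4]; nlinarith
  · rw [h4]
    rcases max_choice ‖p.2.1‖ ‖p.2.2.1‖ with h5 | h5 <;> rw [h5] <;> nlinarith

/-- Differences of competitors have zero trace, so the Jacobian terms vanish and `le_kinForm`, which
sees only ∂̄ of the first component and ∂ of the second, controls both full gradients. -/
theorem exists_norm_sq_le_kinEnergy {Ω : Set ℂ} (h : HasRectifiableBoundary Ω) {ν : ℝ}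
    (hν : ν ∈ Set.Ioo (-1 : ℝ) 1) (G G' : Lp ℂ 2 (bdryMeasure Ω)) :
    ∃ C : ℝ, ∀ x ∈ admissible h G G', ∀ y ∈ admissible h G G',
      ‖x - y‖ ^ 2 ≤ C * kinEnergy ν (x - y) := by
  obtain ⟨C, hC, hCp⟩ := norm_sq_le_of_trace_zero h
  have hν1 : 0 < (1 - |ν|) / 2 := by
    have := abs_lt.2 hν
    linarith
  refine ⟨C * ((1 - |ν|) / 2)⁻¹, fun x hx y hy => ?_⟩
  obtain ⟨⟨hx1, hxG⟩, hx2, hxG'⟩ := hx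
  obtain ⟨⟨hy1, hyG⟩, hy2, hyG'⟩ := hy
  set d := x - y with hd
  have hd1 : d.1 ∈ traceGraph h := (traceGraph h).sub_mem hx1 hy1
  have hd2 : d.2 ∈ traceGraph h := (traceGraph h).sub_mem hx2 hy2
  have hd10 : d.1.2.2.2 = 0 := by
    change x.1.2.2.2 - y.1.2.2.2 = 0
    rw [hxG, hyG, sub_self]
  have hd20 : d.2.2.2.2 = 0 := by
    change x.2.2.2.2 - y.2.2.2.2 = 0
    rw [hxG', hyG', sub_self]
  have hk := le_kinForm (ν := ν) d.1.2.1 d.1.2.2.1 d.2.2.1 d.2.2.2.1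
  rw [norm_add_I_smul_sq _ _ (inner_dx_dy_im_eq_zero hd1 hd10),
    norm_sub_I_smul_sq _ _ (inner_dx_dy_im_eq_zero hd2 hd20)] at hk
  have h1 := hCp _ hd1 hd10
  have h2 := hCp _ hd2 hd20
  have hsum : ‖d‖ ^ 2 ≤ C * (‖d.1.2.1‖ ^ 2 + ‖d.1.2.2.1‖ ^ 2 +
      (‖d.2.2.1‖ ^ 2 + ‖d.2.2.2.1‖ ^ 2)) := by
    have hmax : ‖d‖ = max ‖d.1‖ ‖d.2‖ := rfl
    rw [hmax, mul_add]
    rcases max_choice ‖d.1‖ ‖d.2‖ with h4 | h4 <;> rw [h4]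
    · exact h1.trans (le_add_of_nonneg_right (by positivity))
    · exact h2.trans (le_add_of_nonneg_left (by positivity))
  refine hsum.trans ?_
  rw [mul_assoc]
  refine mul_le_mul_of_nonneg_left ?_ hC
  rw [← div_eq_inv_mul, le_div_iff₀ hν1, mul_comm]
  exact hk

theorem kinEnergy_nonneg {Ω : Set ℂ} {ν : ℝ} (hν : ν ∈ Set.Ioo (-1 : ℝ) 1)
    (x : GraphSpace Ω × GraphSpace Ω) : 0 ≤ kinEnergy ν x := by
  refine le_trans ?_ (le_kinForm _ _ _ _)
  have : 0 ≤ 1 - |ν| := by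
    have := abs_lt.2 hν
    linarith
  positivity

/-- Finiteness follows from the quartic growth of the potential and the L⁴ bound. It ensures that
`potEnergy`, defined through `toReal`, never takes its default value 0 for an infinite integral on
the trace graph. -/
theorem lintegral_pot_lt_top {Ω : Set ℂ} (h : HasRectifiableBoundary Ω) {ν : ℝ}
    (hν : ν ∈ Set.Ioo (-1 : ℝ) 1) (κ : ℝ) {p q : GraphSpace Ω} (hp : p ∈ traceGraph h)
    (hq : q ∈ traceGraph h) :
    ∫⁻ z in Ω, ENNReal.ofReal (κ ^ 2 * pot ν (p.1 z, q.1 z)) < ⊤ := by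
  have hL4 : ∀ r ∈ traceGraph h, ∫⁻ z in Ω, ‖r.1 z‖ₑ ^ 4 < ⊤ := fun r hr =>
    (lintegral_pow_four_le hr (lt_add_one ‖r‖)).trans_lt
      (ENNReal.pow_lt_top (ENNReal.mul_lt_top (by simp) (ENNReal.pow_lt_top ENNReal.ofReal_lt_top)))
  have hm : ∀ r : GraphSpace Ω, AEMeasurable (fun z => 3 * ‖r.1 z‖ₑ ^ 4) (volume.restrict Ω) :=
    fun r => ((Lp.aestronglyMeasurable r.1).enorm.pow_const 4).const_mul 3
  have hb : ∀ z, ENNReal.ofReal (κ ^ 2 * pot ν (p.1 z, q.1 z)) ≤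
      ENNReal.ofReal (κ ^ 2) * (2 + 3 * ‖p.1 z‖ₑ ^ 4 + 3 * ‖q.1 z‖ₑ ^ 4) := by
    intro z
    rw [ENNReal.ofReal_mul (sq_nonneg κ)]
    refine mul_le_mul_right ((ENNReal.ofReal_le_ofReal (pot_le hν _)).trans (le_of_eq ?_)) _
    rw [ENNReal.ofReal_add (by positivity) (by positivity),
      ENNReal.ofReal_add (by positivity) (by positivity), ENNReal.ofReal_mul (by norm_num),
      ENNReal.ofReal_mul (by norm_num), ENNReal.ofReal_pow (norm_nonneg _),
      ENNReal.ofReal_pow (norm_nonneg _), ofReal_norm, ofReal_norm]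
    simp
  refine (lintegral_mono hb).trans_lt ?_
  rw [lintegral_const_mul' _ _ ENNReal.ofReal_ne_top, lintegral_add_right' _ (hm q),
    lintegral_add_right' _ (hm p), lintegral_const_mul' _ _ (by simp),
    lintegral_const_mul' _ _ (by simp), lintegral_const, Measure.restrict_apply_univ]
  refine ENNReal.mul_lt_top ENNReal.ofReal_lt_top (ENNReal.add_lt_top.2
    ⟨ENNReal.add_lt_top.2 ⟨?_, ?_⟩, ?_⟩)
  · exact ENNReal.mul_lt_top (by simp) h.isBounded.measure_lt_top
  · exact ENNReal.mul_lt_top (by simp) (hL4 p hp)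
  · exact ENNReal.mul_lt_top (by simp) (hL4 q hq)

/-- Existence of minimizers in the graph space. -/
theorem exists_minimizer_admissible {Ω : Set ℂ} (h : HasRectifiableBoundary Ω) {ν : ℝ}
    (hν : ν ∈ Set.Ioo (-1 : ℝ) 1) (κ : ℝ) (G G' : Lp ℂ 2 (bdryMeasure Ω))
    (hne : (admissible h G G').Nonempty) :
    ∃ x ∈ admissible h G G', ∀ y ∈ admissible h G G',
      kinEnergy ν x + potEnergy ν κ (x.1.1, x.2.1) ≤
        kinEnergy ν y + potEnergy ν κ (y.1.1, y.2.1) := by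
  obtain ⟨C, hC⟩ := exists_norm_sq_le_kinEnergy h hν G G'
  have hVc : IsClosed (traceGraph h : Set (GraphSpace Ω)) :=
    (smoothGraph h).isClosed_topologicalClosure
  refine exists_isMinOn_add (X := GraphSpace Ω × GraphSpace Ω)
    ((ContinuousLinearMap.fst ℝ (Lp ℂ 2 (volume.restrict Ω)) _).prodMap
      (ContinuousLinearMap.fst ℝ (Lp ℂ 2 (volume.restrict Ω)) _)) ?_ ?_ hne (kinEnergy ν) ?_
    (kinEnergy_nonneg hν) ?_ C hC ?_ (potEnergy ν κ) (fun y => ENNReal.toReal_nonneg) ?_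
  · refine IsClosed.inter (IsClosed.inter (hVc.preimage continuous_fst) ?_)
      (IsClosed.inter (hVc.preimage continuous_snd) ?_)
    · exact isClosed_eq (by fun_prop) continuous_const
    · exact isClosed_eq (by fun_prop) continuous_const
  · rintro x ⟨⟨hx1, hxG⟩, hx2, hxG'⟩ y ⟨⟨hy1, hyG⟩, hy2, hyG'⟩ a b ha hb hab
    refine ⟨⟨(traceGraph h).convex hx1 hy1 ha hb hab, ?_⟩,
      (traceGraph h).convex hx2 hy2 ha hb hab, ?_⟩
    · change a • x.1.2.2.2 + b • y.1.2.2.2 = G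
      rw [hxG, hyG, ← add_smul, hab, one_smul]
    · change a • x.2.2.2.2 + b • y.2.2.2.2 = G'
      rw [hxG', hyG', ← add_smul, hab, one_smul]
  · unfold kinEnergy kinForm
    have hre := Complex.continuous_re
    have him := Complex.continuous_im
    fun_prop
  · intro x y
    exact kinForm_parallelogram ν _ _ _ _ _ _ _ _
  · intro s M hs hM
    obtain ⟨u, φ, hφ, hu⟩ := exists_subseq_tendsto h M (fun n => (hs n).1.1)
      (fun n => (norm_fst_le (s n)).trans (hM n))
    obtain ⟨u', ψ, hψ, hu'⟩ := exists_subseq_tendsto h M (fun n => (hs (φ n)).2.1)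
      (fun n => (norm_snd_le (s (φ n))).trans (hM (φ n)))
    exact ⟨(u, u'), φ ∘ ψ, hφ.comp hψ, (hu.comp hψ.tendsto_atTop).prodMk_nhds hu'⟩
  · intro s x c hs hx hlim hc
    have hc0 : 0 ≤ c := by
      obtain ⟨n, hn⟩ := hc.exists
      exact ENNReal.toReal_nonneg.trans hn
    have h1 : Tendsto (fun n => (s n).1.1) atTop (𝓝 x.1.1) :=
      (continuous_fst.tendsto (x.1.1, x.2.1)).comp hlim
    have h2 : Tendsto (fun n => (s n).2.1) atTop (𝓝 x.2.1) :=
      (continuous_snd.tendsto (x.1.1, x.2.1)).comp hlim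
    refine ENNReal.toReal_le_of_le_ofReal hc0 ?_
    refine lintegral_le_of_tendsto h1 h2 (Φ := fun w => ENNReal.ofReal (κ ^ 2 * pot ν w))
      (ENNReal.continuous_ofReal.comp (continuous_const.mul (continuous_pot ν))) ?_
    filter_upwards [hc] with n hn
    -- A bound on the real number bounds the extended integral only because that integral is finite.
    refine (ENNReal.le_ofReal_iff_toReal_le ?_ hc0).2 hn
    exact (lintegral_pot_lt_top h hν κ (hs n).1.1 (hs n).2.1).ne

/-! ### The energy as a function on the graph space. -/

theorem integral_re_mul_conj {α : Type*} [MeasurableSpace α] {μ : Measure α} {f g : α → ℂ}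
    (hf : MemLp f 2 μ) (hg : MemLp g 2 μ) :
    Integrable (fun z => (g z * conj (f z)).re) μ ∧
      ∫ z, (g z * conj (f z)).re ∂μ = (inner ℂ (hf.toLp f) (hg.toLp g)).re := by
  have h := integrable_mul_conj hf hg
  refine ⟨h.re, ?_⟩
  rw [inner_toLp]
  exact integral_re h

theorem integral_im_mul_conj {α : Type*} [MeasurableSpace α] {μ : Measure α} {f g : α → ℂ}
    (hf : MemLp f 2 μ) (hg : MemLp g 2 μ) :
    Integrable (fun z => (g z * conj (f z)).im) μ ∧
      ∫ z, (g z * conj (f z)).im ∂μ = (inner ℂ (hf.toLp f) (hg.toLp g)).im := by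
  have h := integrable_mul_conj hf hg
  refine ⟨h.im, ?_⟩
  rw [inner_toLp]
  exact integral_im h

/-- The integral of the kinetic energy density. -/
theorem integral_eKin {Ω : Set ℂ} (ν : ℝ) (η : H1 Ω × H1 Ω) {gp gm : ℂ → ℂ}
    (hgp : MemLp gp 2 (bdryMeasure Ω)) (hgm : MemLp gm 2 (bdryMeasure Ω)) :
    IntegrableOn (eKin ν η) Ω ∧
      ∫ z in Ω, eKin ν η z = kinEnergy ν (η.1.toGraphSpace hgp, η.2.toGraphSpace hgm) := by
  -- The dot and wedge products of f and g are the real and imaginary parts of g times the conjugate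
  -- of f, the integrand of ⟨f, g⟩.
  have heq : eKin ν η = fun z =>
      (η.1.dx z * conj (η.1.dx z)).re + (η.1.dy z * conj (η.1.dy z)).re
      + ((η.2.dx z * conj (η.2.dx z)).re + (η.2.dy z * conj (η.2.dy z)).re)
      + (1 + ν) * ((η.2.dx z * conj (η.1.dx z)).re - (η.2.dy z * conj (η.1.dy z)).re)
      + (1 - ν) * ((η.1.dy z * conj (η.2.dx z)).im - (η.2.dy z * conj (η.1.dx z)).im) := by
    funext z
    simp only [eKin, dot, wedge, Complex.sq_norm, Complex.normSq_apply, Complex.mul_re,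
      Complex.mul_im, Complex.conj_re, Complex.conj_im]
    ring
  obtain ⟨i1, e1⟩ := integral_re_mul_conj η.1.memLp_dx η.1.memLp_dx
  obtain ⟨i2, e2⟩ := integral_re_mul_conj η.1.memLp_dy η.1.memLp_dy
  obtain ⟨i3, e3⟩ := integral_re_mul_conj η.2.memLp_dx η.2.memLp_dx
  obtain ⟨i4, e4⟩ := integral_re_mul_conj η.2.memLp_dy η.2.memLp_dy
  obtain ⟨i5, e5⟩ := integral_re_mul_conj η.1.memLp_dx η.2.memLp_dx
  obtain ⟨i6, e6⟩ := integral_re_mul_conj η.1.memLp_dy η.2.memLp_dy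
  obtain ⟨i7, e7⟩ := integral_im_mul_conj η.2.memLp_dx η.1.memLp_dy
  obtain ⟨i8, e8⟩ := integral_im_mul_conj η.1.memLp_dx η.2.memLp_dy
  have j1 := i1.fun_add i2
  have j2 := i3.fun_add i4
  have k1 : Integrable (fun z => (η.2.dx z * conj (η.1.dx z)).re -
    (η.2.dy z * conj (η.1.dy z)).re) (volume.restrict Ω) := i5.sub i6
  have k2 : Integrable (fun z => (η.1.dy z * conj (η.2.dx z)).im -
    (η.2.dy z * conj (η.1.dx z)).im) (volume.restrict Ω) := i7.sub i8
  have j3 := k1.const_mul (1 + ν)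
  have j4 := k2.const_mul (1 - ν)
  rw [heq]
  refine ⟨((j1.fun_add j2).fun_add j3).fun_add j4, ?_⟩
  rw [integral_add ((j1.fun_add j2).fun_add j3) j4, integral_add (j1.fun_add j2) j3, integral_add j1 j2,
    integral_add i1 i2, integral_add i3 i4, integral_const_mul, integral_const_mul,
    integral_sub i5 i6, integral_sub i7 i8, e1, e2, e3, e4, e5, e6, e7, e8]
  rfl

/-- The integral of the potential energy density. -/
theorem integral_ePot {Ω : Set ℂ} (h : HasRectifiableBoundary Ω) {ν : ℝ}
    (hν : ν ∈ Set.Ioo (-1 : ℝ) 1) (κ : ℝ) (η : H1 Ω × H1 Ω) {gp gm : ℂ → ℂ}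
    (hgp : MemLp gp 2 (bdryMeasure Ω)) (hgm : MemLp gm 2 (bdryMeasure Ω))
    (hη : η ∈ W Ω gp gm) :
    IntegrableOn (fun z => κ ^ 2 * ePot ν η z) Ω ∧ ∫ z in Ω, κ ^ 2 * ePot ν η z =
      potEnergy ν κ ((η.1.toGraphSpace hgp).1, (η.2.toGraphSpace hgm).1) := by
  have hp := (hasTrace_iff_mem h η.1 hgp).1 hη.1
  have hq := (hasTrace_iff_mem h η.2 hgm).1 hη.2
  have hfin := lintegral_pot_lt_top h hν κ hp hq
  have hcongr : ∫⁻ z in Ω, ENNReal.ofReal (κ ^ 2 * pot ν ((η.1.toGraphSpace hgp).1 z,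
      (η.2.toGraphSpace hgm).1 z)) = ∫⁻ z in Ω, ENNReal.ofReal (κ ^ 2 * ePot ν η z) := by
    refine lintegral_congr_ae ?_
    filter_upwards [η.1.memLp_toFun.coeFn_toLp, η.2.memLp_toFun.coeFn_toLp] with z h1 h2
    simp only [H1.toGraphSpace, h1, h2]
    rfl
  have hnn : ∀ z, 0 ≤ κ ^ 2 * ePot ν η z := fun z =>
    mul_nonneg (sq_nonneg κ) (pot_nonneg hν (η.1.toFun z, η.2.toFun z))
  have hm : AEStronglyMeasurable (fun z => κ ^ 2 * ePot ν η z) (volume.restrict Ω) :=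
    (((continuous_pot ν).comp_aestronglyMeasurable
      (η.1.memLp_toFun.1.prodMk η.2.memLp_toFun.1)).const_mul (κ ^ 2) :)
  constructor
  · refine ⟨hm, ?_⟩
    rw [hasFiniteIntegral_iff_ofReal (Eventually.of_forall hnn), ← hcongr]
    exact hfin
  · rw [integral_eq_lintegral_of_nonneg_ae (Eventually.of_forall hnn) hm, potEnergy, ← hcongr]

theorem energy_eq {Ω : Set ℂ} (h : HasRectifiableBoundary Ω) {ν : ℝ}
    (hν : ν ∈ Set.Ioo (-1 : ℝ) 1) (κ : ℝ) (η : H1 Ω × H1 Ω) {gp gm : ℂ → ℂ}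
    (hgp : MemLp gp 2 (bdryMeasure Ω)) (hgm : MemLp gm 2 (bdryMeasure Ω))
    (hη : η ∈ W Ω gp gm) :
    IntegrableOn (energyDensity ν κ η) Ω ∧ energy ν κ η =
      kinEnergy ν (η.1.toGraphSpace hgp, η.2.toGraphSpace hgm) +
      potEnergy ν κ ((η.1.toGraphSpace hgp).1, (η.2.toGraphSpace hgm).1) := by
  obtain ⟨i1, e1⟩ := integral_eKin ν η hgp hgm
  obtain ⟨i2, e2⟩ := integral_ePot h hν κ η hgp hgm hη
  refine ⟨i1.add i2, ?_⟩
  rw [← e1, ← e2]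
  exact integral_add i1 i2

/-- The Sobolev function underlying an element of the trace graph. -/
def H1.ofMem {Ω : Set ℂ} {h : HasRectifiableBoundary Ω} {p : GraphSpace Ω}
    (hp : p ∈ traceGraph h) : H1 Ω where
  toFun := p.1
  dx := p.2.1
  dy := p.2.2.1
  memLp_toFun := Lp.memLp _
  memLp_dx := Lp.memLp _
  memLp_dy := Lp.memLp _
  isWeakDeriv_dx := (isWeakDeriv_of_mem hp).1
  isWeakDeriv_dy := (isWeakDeriv_of_mem hp).2

theorem H1.toGraphSpace_ofMem {Ω : Set ℂ} {h : HasRectifiableBoundary Ω} {p : GraphSpace Ω}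
    (hp : p ∈ traceGraph h) {g : ℂ → ℂ} (hg : MemLp g 2 (bdryMeasure Ω))
    (hpg : p.2.2.2 = hg.toLp g) : (H1.ofMem hp).toGraphSpace hg = p :=
  Prod.ext (Lp.toLp_coeFn p.1 (Lp.memLp _)) (Prod.ext (Lp.toLp_coeFn p.2.1 (Lp.memLp _))
    (Prod.ext (Lp.toLp_coeFn p.2.2.1 (Lp.memLp _)) hpg.symm))

/-- The class W and the admissible set correspond with equal energies: a Sobolev pair gives graph
elements, and a minimizer among graphs comes back as a Sobolev pair since graph components are weak
derivatives. Membership in the trace space makes the admissible set nonempty. -/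
theorem hasMinimizer_of_memHHalf {Ω : Set ℂ} (h : HasRectifiableBoundary Ω) {ν : ℝ}
    (hν : ν ∈ Set.Ioo (-1 : ℝ) 1) (κ : ℝ) {gp gm : ℂ → ℂ} (hgp : MemHHalf Ω gp)
    (hgm : MemHHalf Ω gm) : HasMinimizer Ω ν κ gp gm := by
  obtain ⟨hgp, up, hup⟩ := hgp
  obtain ⟨hgm, um, hum⟩ := hgm
  have hmem : ∀ η ∈ W Ω gp gm, (η.1.toGraphSpace hgp, η.2.toGraphSpace hgm) ∈
      admissible h (hgp.toLp gp) (hgm.toLp gm) := fun η hη =>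
    ⟨⟨(hasTrace_iff_mem h η.1 hgp).1 hη.1, rfl⟩, (hasTrace_iff_mem h η.2 hgm).1 hη.2, rfl⟩
  refine ⟨fun ζ hζ => (energy_eq h hν κ ζ hgp hgm hζ).1, ?_⟩
  obtain ⟨x, ⟨⟨hx1, hxG⟩, hx2, hxG'⟩, hmin⟩ := exists_minimizer_admissible h hν κ _ _
    ⟨_, hmem (up, um) ⟨hup, hum⟩⟩
  have e1 := H1.toGraphSpace_ofMem hx1 hgp hxG
  have e2 := H1.toGraphSpace_ofMem hx2 hgm hxG'
  have hW : (H1.ofMem hx1, H1.ofMem hx2) ∈ W Ω gp gm :=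
    ⟨(hasTrace_iff_mem h _ hgp).2 (by rw [e1]; exact hx1),
      (hasTrace_iff_mem h _ hgm).2 (by rw [e2]; exact hx2)⟩
  refine ⟨_, hW, fun ζ hζ => ?_⟩
  rw [(energy_eq h hν κ _ hgp hgm hW).2, (energy_eq h hν κ ζ hgp hgm hζ).2, e1, e2]
  exact hmin _ (hmem ζ hζ)

/-! ### Smooth boundary data and the disc. -/

/-- The restriction of a smooth function to the boundary is a trace. -/
theorem memHHalf_of_smooth {Ω : Set ℂ} (h : HasRectifiableBoundary Ω) {g φ : ℂ → ℂ}
    (hφ : ContDiff ℝ ∞ φ) (hg : ∀ z ∈ frontier Ω, g z = φ z) : MemHHalf Ω g := by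
  have hae : φ =ᵐ[bdryMeasure Ω] g :=
    (ae_restrict_mem isClosed_frontier.measurableSet).mono fun z hz => (hg z hz).symm
  have hgL : MemLp g 2 (bdryMeasure Ω) := (memLp_congr_ae hae).1 (h.memLp_bdry hφ.continuous)
  have hmem := toGraph_mem h hφ
  have hb : (toGraph h hφ).2.2.2 = hgL.toLp g := MemLp.toLp_congr (h.memLp_bdry hφ.continuous) hgL hae
  refine ⟨hgL, H1.ofMem hmem, (hasTrace_iff_mem h _ hgL).2 ?_⟩
  rw [H1.toGraphSpace_ofMem hmem hgL hb]
  exact hmem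

theorem isSmoothBoundedDomain_ball {R : ℝ} (hR : 0 < R) :
    IsSmoothBoundedDomain (Metric.ball (0 : ℂ) R) where
  isOpen := Metric.isOpen_ball
  isConnected := (convex_ball _ _).isConnected ⟨0, Metric.mem_ball_self hR⟩
  isBounded := Metric.isBounded_ball
  smooth_boundary p hp := by
    rw [frontier_ball _ hR.ne', mem_sphere_zero_iff_norm] at hp
    -- The gradient of |z|² - R² vanishes only at the origin, so one chart serves the whole circle.
    refine ⟨{0}ᶜ, isOpen_compl_singleton, ?_, fun z => ‖z‖ ^ 2 - R ^ 2,
      ((contDiff_norm_sq ℝ).sub contDiff_const).contDiffOn, fun x hx hx0 => ?_, ?_⟩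
    · intro h0
      rw [Set.mem_singleton_iff.1 h0, norm_zero] at hp
      exact hR.ne hp
    · have hd : HasFDerivAt (fun z : ℂ => ‖z‖ ^ 2 - R ^ 2) (2 • innerSL ℝ x) x :=
        ((hasStrictFDerivAt_norm_sq x).hasFDerivAt).sub_const _
      rw [hd.fderiv] at hx0
      have := congrArg (fun L : ℂ →L[ℝ] ℝ => L x) hx0
      simp at this
      exact hx this
    · ext z
      simp only [Set.mem_inter_iff, mem_ball_zero_iff, Set.mem_sep_iff, sub_neg]
      rw [and_comm, sq_lt_sq₀ (norm_nonneg z) hR.le]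

/-- On |z| = R the inverse of z/R is its conjugate, so the datum is the restriction of a polynomial
in z or in its conjugate, according to the sign of n. -/
theorem memHHalf_angularData {R : ℝ} (hR : 0 < R) (α : ℂ) (n : ℤ) :
    MemHHalf (Metric.ball (0 : ℂ) R) (angularData α n) := by
  have h := (isSmoothBoundedDomain_ball hR).hasRectifiableBoundary
  have hR' : (R : ℂ) ≠ 0 := by exact_mod_cast hR.ne'
  have hsph : ∀ z ∈ frontier (Metric.ball (0 : ℂ) R), ‖z‖ = R := fun z hz => by
    rwa [frontier_ball _ hR.ne', mem_sphere_zero_iff_norm] at hz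
  obtain ⟨k, rfl | rfl⟩ := n.eq_nat_or_neg
  · refine memHHalf_of_smooth h (φ := fun z => α * (z / (R : ℂ)) ^ k)
      (contDiff_const.mul ((contDiff_id.div_const _).pow k)) fun z hz => ?_
    rw [angularData, hsph z hz, zpow_natCast]
  · refine memHHalf_of_smooth h (φ := fun z => α * (conj z / (R : ℂ)) ^ k)
      (contDiff_const.mul (((contDiff_conj_comp contDiff_id).div_const _).pow k)) fun z hz => ?_
    rw [angularData, hsph z hz, zpow_neg, zpow_natCast, ← inv_pow, inv_div]
    congr 2
    have hz0 : z ≠ 0 := fun h0 => hR.ne' (by rw [← hsph z hz, h0, norm_zero])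
    rw [div_eq_div_iff hz0 hR', mul_comm (conj z), Complex.mul_conj, Complex.normSq_eq_norm_sq,
      hsph z hz]
    push_cast
    ring

end PWave

end

theorem theorem1 (ν κ : ℝ) (hν : ν ∈ Set.Ioo (-1 : ℝ) 1) :
    (∀ Ω : Set ℂ, PWave.IsSmoothBoundedDomain Ω →
      ∀ gp gm : ℂ → ℂ, PWave.MemHHalf Ω gp → PWave.MemHHalf Ω gm →
        (∀ cp cm α : ℂ, ¬ ∃ η ∈ PWave.W Ω gp gm,
          η.1.toFun =ᵐ[volume.restrict Ω] (fun z => cp + α * z) ∧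
          η.2.toFun =ᵐ[volume.restrict Ω] (fun z => cm - α * conj z)) →
        PWave.HasMinimizer Ω ν κ gp gm) ∧
    (∀ R : ℝ, 0 < R → ∀ (αp αm : ℂ) (np nm : ℤ),
      ¬ (np = 1 ∧ nm = -1 ∧ αp = -αm) →
        PWave.HasMinimizer (Metric.ball (0 : ℂ) R) ν κ
          (PWave.angularData αp np) (PWave.angularData αm nm)) :=
  ⟨fun _ hΩ _ _ hgp hgm _ =>
      PWave.hasMinimizer_of_memHHalf hΩ.hasRectifiableBoundary hν κ hgp hgm,
    fun _ hR αp αm np nm _ =>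
      PWave.hasMinimizer_of_memHHalf
        (PWave.isSmoothBoundedDomain_ball hR).hasRectifiableBoundary hν κ
        (PWave.memHHalf_angularData hR αp np) (PWave.memHHalf_angularData hR αm nm)⟩
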